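/- **Setting.** All signals are real and all systems start from zero initial state. Let $F(s)$ be a stable, strictly proper and $P(s)$ a stable, proper real rational transfer function (stable: all poles have negative real part), given by state-space realizations $\{A_F,B_F,C_F,0\}$ and $\{A_P,B_P,C_P,D_P\}$; a realization $\{A,B,C,D\}$ acts by $(Gu)(t)=\int_0^tCe^{A(t-\tau)}Bu(\tau)\,d\tau+Du(t)$. Let $K(z)$ be a digital filter, i.e. a causal finite-dimensional time-invariant discrete-time system with one input and one output. Let $L\ge 1$ and $m\ge 0$ be integers and $h>0$. Put * $(\mathcal S_hu)[k]=u(kh)$ (sampler) and $(\mathcal H_hv)(kh+\theta)=v[k]$, $0\le\theta<h$ (zero-order hold); * $\uparrow\! L:\ \{x[0],x[1],\dots\}\mapsto\{x[0],0,\dots,0,x[1],0,\dots\}$ with $L-1$ zeros inserted after each sample; * $\mathbf L_N$ the discrete-time lifting, $(\mathbf L_Nv)[k]=[v[kN],v[kN+1],\dots,v[kN+N-1]]^T$, and $\mathbf L_N^{-1}$ its inverse; * $\mathrm{dlift}_N(G):=\mathbf L_N\mathcal S_{h/N}\,G\,\mathcal H_{h/N}\mathbf L_N^{-1}$ for a continuous-time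 system $G$; * $\widetilde K:=\mathbf L_LK\mathbf L_L^{-1}[1\ 0\ \cdots\ 0]^T$; * $\widetilde{\mathcal H}_h$ the generalized hold, which maps a sequence $v$ with values in $\mathbb R^L$ to $u(kh+\theta)=v_j[k]$ for $jh/L\le\theta<(j+1)h/L$, $j=0,\dots,L-1$. The interpolation error system is $$\mathcal T_I:=e^{-mhs}F-P\,\mathcal H_{h/L}\,K\,(\uparrow\! L)\,\mathcal S_h\,F ,$$ where $e^{-mhs}$ is the delay by $mh$. Let $\|\mathcal T_I\|\in[0,\infty]$ be its $L^2[0,\infty)$-induced norm $\sup_{0\ne w\in L^2}\|\mathcal T_Iw\|/\|w\|$, and for discrete-time systems let $\|\cdot\|$ be the $\ell^2$-induced norm in $[0,\infty]$, defined in the same way. **Theorem.** 1. $K(\uparrow\! L)=\mathbf L_L^{-1}\widetilde K$, and $\widetilde K$ is a finite-dimensional time-invariant discrete-time system with one input and $L$ outputs. 2. $\mathcal H_{h/L}\mathbf L_L^{-1}=\widetilde{\mathcal H}_h$. 3. Consequently $\mathcal T_I$ has the single-rate form $\mathcal T_I=e^{-mhs}F-P\,\widetilde{\mathcal H}_h\,\widetilde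 K\,\mathcal S_h\,F$. 4. There are finite-dimensional time-invariant discrete-time systems $T_{I,N}$, $N=Ll$, $l=1,2,\dots$, with $N$ inputs and $N$ outputs, such that $$T_{I,N}=z^{-m}G_{I11,N}+G_{I12,N}\,\widetilde K\,G_{I21,N}=\mathbf L_N\mathcal S_{h/N}\,\mathcal T_I\,\mathcal H_{h/N}\mathbf L_N^{-1},$$ where $$G_{I11,N}=\mathrm{dlift}_N(F),\qquad G_{I12,N}=-\mathrm{dlift}_N(P)H,\qquad G_{I21,N}=S\,\mathrm{dlift}_N(F),$$ $S=[1,0,\dots,0]\in\mathbb R^{1\times N}$, and $H=\mathrm{diag}(q,\dots,q)\in\mathbb R^{N\times L}$ has $L$ diagonal blocks $q=[1,\dots,1]^T\in\mathbb R^l$; and these systems satisfy $$\lim_{N\to\infty}\|T_{I,N}\|=\|\mathcal T_I\| .$$ -/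

import Mathlib

open Filter Topology MeasureTheory
open scoped ENNReal Matrix

namespace SampledData

noncomputable section

/-! ### Signals

A continuous-time signal is a function `ℝ → ℝ` of which only the values on `[0, ∞)` matter,
a scalar discrete-time signal is a sequence `ℕ → ℝ`, and a `q`-dimensional one is a sequence
`ℕ → Fin q → ℝ`. -/

/-- The norm of `L²[0, ∞)`, with value `∞` outside that space. -/
def normL2 (u : ℝ → ℝ) : ℝ≥0∞ :=
  eLpNorm u 2 (volume.restrict (Set.Ici 0))

/-- Membership in `L²[0, ∞)`. -/
def MemL2 (u : ℝ → ℝ) : Prop :=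
  MemLp u 2 (volume.restrict (Set.Ici 0))

/-- The norm of `ℓ²` (vector values carry the Euclidean norm), with value `∞` outside that
space. -/
def norml2 {q : ℕ} (v : ℕ → Fin q → ℝ) : ℝ≥0∞ :=
  (∑' k, ∑ i, ‖v k i‖ₑ ^ 2) ^ (1 / 2 : ℝ)

/-- The `L²` induced norm, `sup ‖T w‖ / ‖w‖` over the nonzero `w` in `L²[0, ∞)`. -/
def inducedNormL2 (T : (ℝ → ℝ) → (ℝ → ℝ)) : ℝ≥0∞ :=
  ⨆ (w : ℝ → ℝ) (_ : MemL2 w) (_ : normL2 w ≠ 0), normL2 (T w) / normL2 w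

/-- The `ℓ²` induced norm, `sup ‖T w‖ / ‖w‖` over the nonzero `w` in `ℓ²`. -/
def inducedNorml2 {p q : ℕ} (T : (ℕ → Fin p → ℝ) → (ℕ → Fin q → ℝ)) : ℝ≥0∞ :=
  ⨆ (w : ℕ → Fin p → ℝ) (_ : norml2 w ≠ ∞) (_ : norml2 w ≠ 0), norml2 (T w) / norml2 w

/-! ### Finite-dimensional continuous-time and discrete-time systems -/

/-- A single-input single-output continuous-time system given by a realization:
`x' = A x + B u`, `y = C x + D u`. -/
structure CTSystem (n : ℕ) where
  A : Matrix (Fin n) (Fin n) ℝ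
  B : Fin n → ℝ
  C : Fin n → ℝ
  D : ℝ

namespace CTSystem

variable {n : ℕ}

/-- The transfer function `C (s I - A)⁻¹ B + D`, a real rational function of `s`. -/
def transfer (G : CTSystem n) : RatFunc ℝ :=
  (fun i => RatFunc.C (G.C i)) ⬝ᵥ
      (((RatFunc.X : RatFunc ℝ) • (1 : Matrix (Fin n) (Fin n) (RatFunc ℝ)) -
          G.A.map RatFunc.C)⁻¹ *ᵥ
        (fun i => RatFunc.C (G.B i))) +
    RatFunc.C G.D

/-- The transfer function is stable: all its poles have negative real part. -/
def IsStable (G : CTSystem n) : Prop :=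
  ∀ s : ℂ, Polynomial.aeval s G.transfer.denom = 0 → s.re < 0

/-- The input/output operator with zero initial state,
`y(t) = ∫₀ᵗ C e^{A(t-τ)} B u(τ) dτ + D u(t)` for `t ≥ 0`. -/
def response (G : CTSystem n) (u : ℝ → ℝ) (t : ℝ) : ℝ :=
  (∫ τ in (0 : ℝ)..t, (G.C ⬝ᵥ (NormedSpace.exp ((t - τ) • G.A) *ᵥ G.B)) * u τ) + G.D * u t

end CTSystem

/-- A discrete-time system with `p` inputs, `q` outputs and an `n`-dimensional state:
`x[k+1] = A x[k] + B u[k]`, `y[k] = C x[k] + D u[k]`. -/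
structure DTSystem (n p q : ℕ) where
  A : Matrix (Fin n) (Fin n) ℝ
  B : Matrix (Fin n) (Fin p) ℝ
  C : Matrix (Fin q) (Fin n) ℝ
  D : Matrix (Fin q) (Fin p) ℝ

namespace DTSystem

variable {n p q : ℕ}

/-- The state sequence with zero initial state. -/
def state (G : DTSystem n p q) (u : ℕ → Fin p → ℝ) : ℕ → Fin n → ℝ
  | 0 => 0
  | k + 1 => G.A *ᵥ G.state u k + G.B *ᵥ u k

/-- The input/output operator with zero initial state. -/
def response (G : DTSystem n p q) (u : ℕ → Fin p → ℝ) (k : ℕ) : Fin q → ℝ :=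
  G.C *ᵥ G.state u k + G.D *ᵥ u k

/-- The input/output operator of a single-input single-output system on scalar signals. -/
def scalarResponse (G : DTSystem n 1 1) (u : ℕ → ℝ) (k : ℕ) : ℝ :=
  G.response (fun j _ => u j) k 0

end DTSystem

/-! ### Interface operators -/

/-- The ideal sampler `S_h`. -/
def sampler (h : ℝ) (u : ℝ → ℝ) (k : ℕ) : ℝ :=
  u (k * h)

/-- The zero-order hold `H_h`: `u(kh + θ) = v[k]` for `0 ≤ θ < h`. -/
def zoh (h : ℝ) (v : ℕ → ℝ) (t : ℝ) : ℝ :=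
  if 0 ≤ t then v ⌊t / h⌋₊ else 0

/-- The generalized hold of period `h` for `L`-dimensional signals:
`u(kh + θ) = v[k]_j` for `j h / L ≤ θ < (j + 1) h / L`. -/
def genHold (h : ℝ) {L : ℕ} (v : ℕ → Fin L → ℝ) (t : ℝ) : ℝ :=
  if 0 ≤ t then
    ∑ j : Fin L, Set.indicator (Set.Ico ((j : ℝ) * (h / L)) (((j : ℝ) + 1) * (h / L)))
      (fun _ => v ⌊t / h⌋₊ j) (t - ⌊t / h⌋₊ * h)
  else 0

/-- The continuous-time delay `e^{-ds}`. -/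
def delay (d : ℝ) (u : ℝ → ℝ) (t : ℝ) : ℝ :=
  if d ≤ t then u (t - d) else 0

/-- The discrete-time delay `z^{-m}`. -/
def zDelay (m : ℕ) {q : ℕ} (v : ℕ → Fin q → ℝ) (k : ℕ) : Fin q → ℝ :=
  if m ≤ k then v (k - m) else 0

/-- The upsampler `↑L`. -/
def upsample (L : ℕ) (v : ℕ → ℝ) (k : ℕ) : ℝ :=
  if L ∣ k then v (k / L) else 0

/-- Discrete-time lifting `𝐋_N`. -/
def lift (N : ℕ) (v : ℕ → ℝ) (k : ℕ) (i : Fin N) : ℝ :=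
  v (k * N + i)

/-- Inverse discrete-time lifting `𝐋_N⁻¹` (the value for `N = 0` is irrelevant). -/
def unlift (N : ℕ) (v : ℕ → Fin N → ℝ) (k : ℕ) : ℝ :=
  if hN : 0 < N then v (k / N) ⟨k % N, Nat.mod_lt k hN⟩ else 0

/-- The column `[1 0 ⋯ 0]ᵀ` as an operator on signals. -/
def firstColumn (L : ℕ) (v : ℕ → ℝ) (k : ℕ) (i : Fin L) : ℝ :=
  if (i : ℕ) = 0 then v k else 0

/-- The lifted filter `K̃ = 𝐋_L K 𝐋_L⁻¹ [1 0 ⋯ 0]ᵀ`. -/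
def liftedFilter {n : ℕ} (K : DTSystem n 1 1) (L : ℕ) (v : ℕ → ℝ) : ℕ → Fin L → ℝ :=
  lift L (K.scalarResponse (unlift L (firstColumn L v)))

/-- Fast discretization followed by lifting of a continuous-time operator:
`𝐋_N S_{h/N} G H_{h/N} 𝐋_N⁻¹`. -/
def fastLift (h : ℝ) (N : ℕ) (G : (ℝ → ℝ) → (ℝ → ℝ)) (v : ℕ → Fin N → ℝ) : ℕ → Fin N → ℝ :=
  lift N (sampler (h / N) (G (zoh (h / N) (unlift N v))))

/-- The row `S = [1 0 ⋯ 0]` of length `N`. -/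
def rowS (N : ℕ) : Fin N → ℝ :=
  fun i => if (i : ℕ) = 0 then 1 else 0

/-- The matrix `H = diag(q, …, q)` with `L` blocks `q = [1 ⋯ 1]ᵀ` of length `l`. -/
def matH (L l : ℕ) : Matrix (Fin (L * l)) (Fin L) ℝ :=
  Matrix.of fun i j => if (i : ℕ) / l = j then 1 else 0

/-! ### The interpolation error system and its approximations -/

/-- The error system `𝒯_I = e^{-mhs} F - P H_{h/L} K (↑L) S_h F`. -/
def interpError {nF nP nK : ℕ} (F : CTSystem nF) (P : CTSystem nP) (K : DTSystem nK 1 1)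
    (L m : ℕ) (h : ℝ) (w : ℝ → ℝ) (t : ℝ) : ℝ :=
  delay (m * h) (F.response w) t -
    P.response (zoh (h / L) (K.scalarResponse (upsample L (sampler h (F.response w))))) t

/-- `G_{I11,N}`, the fast-lifted `F`. -/
def G11 {nF : ℕ} (F : CTSystem nF) (h : ℝ) (N : ℕ) : (ℕ → Fin N → ℝ) → (ℕ → Fin N → ℝ) :=
  fastLift h N F.response

/-- `G_{I12,N}`, minus the fast-lifted `P` times `H`, with `N = L l`. -/
def G12 {nP : ℕ} (P : CTSystem nP) (h : ℝ) (L l : ℕ) (v : ℕ → Fin L → ℝ) :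
    ℕ → Fin (L * l) → ℝ :=
  -fastLift h (L * l) P.response (fun k => matH L l *ᵥ v k)

/-- `G_{I21,N}`, `S` times the fast-lifted `F`. -/
def G21 {nF : ℕ} (F : CTSystem nF) (h : ℝ) (N : ℕ) (v : ℕ → Fin N → ℝ) (k : ℕ) : ℝ :=
  rowS N ⬝ᵥ fastLift h N F.response v k

end

end SampledData

/-! The algebraic claims are bookkeeping. Zero insertion fills only the first slot of each block;
repeating every value `l` times turns the hold of period `h / N` into the hold of period `h / L`; a
delay by `m * h` is exactly `m` blocks. Finite dimensionality follows because linear state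
recursions are closed under sums, cascades, delays and lifting (`Realizable`).

The content is the limit of the norms. Lifting is an isometry and a hold of period `δ = h / N`
scales norms by `√δ`, so the norm of the lifted system is the supremum of `‖S_δ T u‖ / ‖u‖` over
held inputs `u`, where `S_δ` samples and holds the output (`norml2_fastLift_div`).

Lower estimate: an input `w` is approximated in `L²` by held signals `u_l`. Since `F` is strictly
proper, `S_δ T u_l` converges pointwise to `T w` on `[0, ∞)`; Fatou's lemma then bounds `‖T w‖ /
‖w‖` by the limit inferior of the discrete norms. Only convergence on finite horizons enters, so the
case `‖T‖ = ∞` is included.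

Upper estimate: `S_δ T u` differs from `T u` by `O(δ) (‖T u‖ + ‖u‖)`. For the `F` branch this is a
mean value bound on an exponentially decaying kernel. The `P` branch is driven by a hold of the
fixed period `h / L`, so on each slot its output `y` ranges over a fixed finite-dimensional space of
smooth functions, where the Lipschitz constant is controlled by the `L²` norm; its error is thus
`O(δ) ‖y‖`. Finally `‖y‖ ≤ ‖T u‖ + C ‖u‖`, as `T u` is the delayed `F u` minus `y`, so `K` need not
be bounded.

Stability refers to the poles of the transfer function, and a nonminimal `A` may have unstable
hidden modes. Decay of `C e^{tA} B` is therefore derived from the reduced denominator, which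
annihilates the Markov parameters, by peeling off its complex roots one at a time. -/

namespace SampledData

noncomputable section

/-! ### Realizability by a finite-dimensional linear state recursion -/

/-- `T` is the input/output map, from zero initial state, of a time-invariant linear state
recursion on a finite-dimensional space. -/
def Realizable {U Y : Type} [AddCommGroup U] [Module ℝ U] [AddCommGroup Y] [Module ℝ Y]
    (T : (ℕ → U) → (ℕ → Y)) : Prop :=
  ∃ (E : Type) (_ : AddCommGroup E) (_ : Module ℝ E) (_ : FiniteDimensional ℝ E)
    (A : E →ₗ[ℝ] E) (B : U →ₗ[ℝ] E) (C : E →ₗ[ℝ] Y) (D : U →ₗ[ℝ] Y),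
    ∀ u : ℕ → U, ∃ x : ℕ → E, x 0 = 0 ∧
      ∀ k, x (k + 1) = A (x k) + B (u k) ∧ T u k = C (x k) + D (u k)

namespace Realizable

variable {U V Y : Type} [AddCommGroup U] [Module ℝ U] [AddCommGroup V] [Module ℝ V]
  [AddCommGroup Y] [Module ℝ Y]

theorem static (D : U →ₗ[ℝ] Y) : Realizable (fun (u : ℕ → U) k => D (u k)) :=
  ⟨Fin 0 → ℝ, inferInstance, inferInstance, inferInstance, 0, 0, 0, D,
    fun _ => ⟨0, rfl, fun _ => by simp⟩⟩

theorem comp {T : (ℕ → V) → (ℕ → Y)} {S : (ℕ → U) → (ℕ → V)} (hT : Realizable T)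
    (hS : Realizable S) : Realizable (fun u => T (S u)) := by
  obtain ⟨E, _, _, _, A, B, C, D, h⟩ := hT
  obtain ⟨E', _, _, _, A', B', C', D', h'⟩ := hS
  refine ⟨E × E', inferInstance, inferInstance, inferInstance,
    LinearMap.prod (A ∘ₗ LinearMap.fst ℝ E E' + B ∘ₗ C' ∘ₗ LinearMap.snd ℝ E E')
      (A' ∘ₗ LinearMap.snd ℝ E E'),
    LinearMap.prod (B ∘ₗ D') B',
    C ∘ₗ LinearMap.fst ℝ E E' + D ∘ₗ C' ∘ₗ LinearMap.snd ℝ E E', D ∘ₗ D', fun u => ?_⟩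
  obtain ⟨x', hx0', hx'⟩ := h' u
  obtain ⟨x, hx0, hx⟩ := h (S u)
  refine ⟨fun k => (x k, x' k), by simp [hx0, hx0'], fun k => ⟨?_, ?_⟩⟩
  · simp [(hx k).1, (hx' k).1, (hx' k).2, add_assoc]
  · simp [(hx k).2, (hx' k).2, add_assoc]

theorem add {T S : (ℕ → U) → (ℕ → Y)} (hT : Realizable T) (hS : Realizable S) :
    Realizable (fun u => T u + S u) := by
  obtain ⟨E, _, _, _, A, B, C, D, h⟩ := hT
  obtain ⟨E', _, _, _, A', B', C', D', h'⟩ := hS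
  refine ⟨E × E', inferInstance, inferInstance, inferInstance, LinearMap.prodMap A A',
    LinearMap.prod B B', LinearMap.coprod C C', D + D', fun u => ?_⟩
  obtain ⟨x', hx0', hx'⟩ := h' u
  obtain ⟨x, hx0, hx⟩ := h u
  refine ⟨fun k => (x k, x' k), by simp [hx0, hx0'], fun k => ⟨?_, ?_⟩⟩
  · simp [(hx k).1, (hx' k).1]
  · simp only [Pi.add_apply, (hx k).2, (hx' k).2, LinearMap.coprod_apply, LinearMap.add_apply]
    abel

theorem unitDelay [FiniteDimensional ℝ U] :
    Realizable (fun (u : ℕ → U) k => if 1 ≤ k then u (k - 1) else 0) :=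
  ⟨U, inferInstance, inferInstance, inferInstance, 0, LinearMap.id, LinearMap.id, 0, fun u =>
    ⟨fun k => if 1 ≤ k then u (k - 1) else 0, by simp, fun k => by simp⟩⟩

theorem zDelay (m q : ℕ) : Realizable (SampledData.zDelay m (q := q)) := by
  induction m with
  | zero =>
    convert static (U := Fin q → ℝ) LinearMap.id using 1
    funext u k
    simp [SampledData.zDelay]
  | succ m ih =>
    convert unitDelay.comp ih using 1
    funext u k
    rcases Nat.eq_zero_or_pos k with rfl | hk
    · simp [SampledData.zDelay]
    · simp only [SampledData.zDelay, show 1 ≤ k from hk, if_true]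
      by_cases h : m + 1 ≤ k
      · rw [if_pos h, if_pos (by omega)]; congr 1; omega
      · rw [if_neg h, if_neg (by omega)]

theorem dtSystem {n p q : ℕ} (G : DTSystem n p q) : Realizable G.response :=
  ⟨Fin n → ℝ, inferInstance, inferInstance, inferInstance, G.A.mulVecLin, G.B.mulVecLin,
    G.C.mulVecLin, G.D.mulVecLin, fun u => ⟨G.state u, rfl, fun _ => ⟨rfl, rfl⟩⟩⟩

theorem dtSystem_scalar {n : ℕ} (G : DTSystem n 1 1) : Realizable G.scalarResponse :=
  ((static (LinearMap.proj (R := ℝ) (φ := fun _ : Fin 1 => ℝ) 0)).comp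
    ((dtSystem G).comp (static (LinearMap.pi fun _ : Fin 1 => LinearMap.id (R := ℝ) (M := ℝ)))))

/-- A realizable operator between vector signals is the response of a discrete-time system. -/
theorem exists_dtSystem {p q : ℕ} {T : (ℕ → Fin p → ℝ) → (ℕ → Fin q → ℝ)}
    (hT : Realizable T) : ∃ (n : ℕ) (G : DTSystem n p q), ∀ u, G.response u = T u := by
  obtain ⟨E, _, _, _, A, B, C, D, h⟩ := hT
  let e := (Module.finBasis ℝ E).equivFun
  let G : DTSystem (Module.finrank ℝ E) p q :=
    ⟨LinearMap.toMatrix' (e.toLinearMap ∘ₗ A ∘ₗ e.symm.toLinearMap),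
      LinearMap.toMatrix' (e.toLinearMap ∘ₗ B), LinearMap.toMatrix' (C ∘ₗ e.symm.toLinearMap),
      LinearMap.toMatrix' D⟩
  refine ⟨_, G, fun u => ?_⟩
  obtain ⟨x, hx0, hx⟩ := h u
  have hs : ∀ k, G.state u k = e (x k) := by
    intro k
    induction k with
    | zero => simp [DTSystem.state, hx0]
    | succ k ih =>
      rw [DTSystem.state, ih, (hx k).1]
      simp only [G, LinearMap.toMatrix'_mulVec]
      simp
  funext k
  rw [DTSystem.response, hs, (hx k).2]
  simp only [G, LinearMap.toMatrix'_mulVec]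
  simp

end Realizable

/-! ### Lifting -/

theorem lift_unlift {N : ℕ} (hN : 0 < N) (v : ℕ → Fin N → ℝ) : lift N (unlift N v) = v := by
  funext k i
  simp only [lift, unlift, hN, dif_pos]
  have h1 : (k * N + (i : ℕ)) / N = k := by
    rw [mul_comm, Nat.mul_add_div hN, Nat.div_eq_of_lt i.2, add_zero]
  have h2 : (k * N + (i : ℕ)) % N = i := by
    rw [mul_comm, Nat.mul_add_mod, Nat.mod_eq_of_lt i.2]
  simp [h1, h2]

theorem unlift_lift {N : ℕ} (hN : 0 < N) (v : ℕ → ℝ) : unlift N (lift N v) = v := by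
  funext k
  simp only [lift, unlift, hN, dif_pos]
  congr 1
  rw [mul_comm]; exact Nat.div_add_mod k N

/-- The state after `i` steps inside a block, as a function of the state at the start of the
block and the lifted input. -/
def blockState {E : Type} [AddCommGroup E] [Module ℝ E] (A : E →ₗ[ℝ] E) (B : ℝ →ₗ[ℝ] E)
    (N : ℕ) : ℕ → (E × (Fin N → ℝ) →ₗ[ℝ] E)
  | 0 => LinearMap.fst ℝ _ _
  | i + 1 => A ∘ₗ blockState A B N i +
      if hi : i < N then B ∘ₗ LinearMap.proj ⟨i, hi⟩ ∘ₗ LinearMap.snd ℝ _ _ else 0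

/-- The original state sampled at the block starts `k * N` serves as the state of the lifted system.
Within a block everything is linear in that state and the block input, and linearity splits the two
contributions. -/
theorem Realizable.lift_unlift {N : ℕ} (hN : 0 < N) {T : (ℕ → ℝ) → (ℕ → ℝ)}
    (hT : Realizable T) : Realizable (fun v => lift N (T (unlift N v))) := by
  obtain ⟨E, _, _, _, A, B, C, D, h⟩ := hT
  let X := blockState A B N
  refine ⟨E, inferInstance, inferInstance, inferInstance, X N ∘ₗ LinearMap.inl ℝ _ _,
    X N ∘ₗ LinearMap.inr ℝ _ _, LinearMap.pi fun i => C ∘ₗ X i ∘ₗ LinearMap.inl ℝ _ _,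
    LinearMap.pi fun i => C ∘ₗ X i ∘ₗ LinearMap.inr ℝ _ _ + D ∘ₗ LinearMap.proj i,
    fun v => ?_⟩
  obtain ⟨x, hx0, hx⟩ := h (unlift N v)
  have hu : ∀ k (i : Fin N), unlift N v (k * N + i) = v k i := fun k i =>
    congrFun (congrFun (SampledData.lift_unlift hN v) k) i
  have key : ∀ k i, i ≤ N → x (k * N + i) = X i (x (k * N), v k) := by
    intro k i
    induction i with
    | zero => intro _; simp [X, blockState]
    | succ i ih =>
      intro hi
      rw [← add_assoc, (hx _).1, ih (by omega)]
      have : i < N := by omega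
      simp [X, blockState, this, hu k ⟨i, this⟩]
  have hsplit : ∀ i k, X i (x (k * N), v k) =
      (X i) (x (k * N), 0) + X i (0, v k) := fun i k => by rw [← map_add]; simp
  refine ⟨fun k => x (k * N), by simp [hx0], fun k => ⟨?_, ?_⟩⟩
  · show x ((k + 1) * N) = _
    rw [add_mul, one_mul, key k N le_rfl, hsplit]
    rfl
  · funext i
    show T (unlift N v) (k * N + i) = _
    rw [(hx _).2, key k i i.2.le, hsplit, hu, map_add, add_assoc]
    rfl

theorem upsample_eq_unlift {L : ℕ} (hL : 0 < L) (v : ℕ → ℝ) :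
    upsample L v = unlift L (firstColumn L v) := by
  funext k
  simp only [upsample, unlift, firstColumn, hL, dif_pos, Nat.dvd_iff_mod_eq_zero]

theorem scalarResponse_upsample {n L : ℕ} (hL : 0 < L) (K : DTSystem n 1 1) (v : ℕ → ℝ) :
    K.scalarResponse (upsample L v) = unlift L (liftedFilter K L v) := by
  rw [liftedFilter, unlift_lift hL, upsample_eq_unlift hL]

theorem realizable_liftedFilter {n L : ℕ} (hL : 0 < L) (K : DTSystem n 1 1) :
    Realizable (liftedFilter K L) := by
  refine ((Realizable.dtSystem_scalar K).lift_unlift hL).comp (S := firstColumn L) ?_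
  have : firstColumn L = fun v k => (LinearMap.pi fun i : Fin L =>
      if (i : ℕ) = 0 then LinearMap.id (R := ℝ) (M := ℝ) else 0) (v k) := by
    funext v k i
    simp only [firstColumn, LinearMap.pi_apply]
    split_ifs <;> simp
  rw [this]
  exact Realizable.static _

/-! ### Holds -/

theorem zoh_unlift_eq_genHold {h : ℝ} (hh : 0 < h) {L : ℕ} (hL : 0 < L)
    (v : ℕ → Fin L → ℝ) : zoh (h / L) (unlift L v) = genHold h v := by
  funext t
  unfold zoh genHold
  split_ifs with ht
  swap; · rfl
  have hL' : (0 : ℝ) < L := by exact_mod_cast hL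
  set s := ⌊t / (h / L)⌋₊ with hs
  have hd : 0 < h / L := by positivity
  have hk : ⌊t / h⌋₊ = s / L := by
    rw [hs, ← Nat.floor_div_natCast]; congr 1; field_simp
  have hmod : s = s / L * L + s % L := by rw [mul_comm]; exact (Nat.div_add_mod s L).symm
  have hmodR : (s : ℝ) = (s / L : ℕ) * L + (s % L : ℕ) := by exact_mod_cast hmod
  have h1 : s * (h / L) ≤ t := by
    rw [← le_div_iff₀ hd]; exact Nat.floor_le (by positivity)
  have h2 : t < (s + 1) * (h / L) := by
    rw [← div_lt_iff₀ hd]; exact Nat.lt_floor_add_one _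
  -- From here `t` lies in fast slot `s`, and `s = (s / L) * L + s % L` names the period and the
  -- subinterval inside it.
  have hh' : h = L * (h / L) := by field_simp
  rw [hk, Finset.sum_eq_single ⟨s % L, Nat.mod_lt s hL⟩]
  · rw [Set.indicator_of_mem]
    · simp [unlift, hL]
    · constructor
      · simp only
        rw [hmodR] at h1
        nlinarith
      · simp only
        rw [hmodR] at h2
        nlinarith
  · intro j _ hj
    rw [Set.indicator_of_notMem]
    rintro ⟨h3, h4⟩
    apply hj
    have h5 : ((s / L * L + j : ℕ) : ℝ) < s + 1 := by
      push_cast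
      by_contra! hc
      have : (s + 1) * (h / L) ≤ ((s / L : ℕ) * L + j) * (h / L) := by gcongr
      nlinarith
    have h6 : (s : ℝ) < ((s / L * L + j + 1 : ℕ) : ℝ) := by
      push_cast
      by_contra! hc
      have : ((s / L : ℕ) * L + j + 1) * (h / L) ≤ s * (h / L) := by gcongr
      nlinarith
    have h5' : s / L * L + j < s + 1 := by exact_mod_cast h5
    have h6' : s < s / L * L + j + 1 := by exact_mod_cast h6
    apply Fin.ext
    simp only
    omega
  · simp

theorem unlift_matH_mulVec {L l : ℕ} (hL : 0 < L) (hl : 0 < l) (v : ℕ → Fin L → ℝ) (k : ℕ) :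
    unlift (L * l) (fun k => matH L l *ᵥ v k) k = unlift L v (k / l) := by
  have hN : 0 < L * l := Nat.mul_pos hL hl
  simp only [unlift, hN, hL, dif_pos, matH, Matrix.mulVec, dotProduct, Matrix.of_apply]
  have h1 : k / (L * l) = k / l / L := by rw [Nat.div_div_eq_div_mul, mul_comm]
  have h2 : k % (L * l) / l = k / l % L := by
    rw [mul_comm, Nat.mod_mul_right_div_self]
  rw [h1, h2, Finset.sum_eq_single ⟨k / l % L, Nat.mod_lt _ hL⟩]
  · simp
  · intro j _ hj
    rw [if_neg (fun hc => hj (Fin.ext hc.symm)), zero_mul]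
  · simp

/-- `H` repeats each value `l` times, so holding at the fast rate reproduces the slow hold: `⌊⌊x⌋ /
l⌋ = ⌊x / l⌋`. -/
theorem zoh_unlift_matH {L l : ℕ} (hL : 0 < L) (hl : 0 < l) (h : ℝ) (v : ℕ → Fin L → ℝ) :
    zoh (h / (L * l : ℕ)) (unlift (L * l) (fun k => matH L l *ᵥ v k)) =
      zoh (h / L) (unlift L v) := by
  funext t
  unfold zoh
  rw [unlift_matH_mulVec hL hl, ← Nat.floor_div_natCast]
  congr 3
  have : (l : ℝ) ≠ 0 := by exact_mod_cast hl.ne'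
  push_cast
  rw [div_div_eq_mul_div, div_div_eq_mul_div]
  field_simp

theorem G21_eq {nF : ℕ} (F : CTSystem nF) (h : ℝ) {N : ℕ} (hN : 0 < N)
    (v : ℕ → Fin N → ℝ) :
    G21 F h N v = sampler h (F.response (zoh (h / N) (unlift N v))) := by
  funext k
  have : (N : ℝ) ≠ 0 := by exact_mod_cast hN.ne'
  simp only [G21, rowS, dotProduct, fastLift, lift, sampler]
  rw [Finset.sum_eq_single ⟨0, hN⟩]
  · simp only [if_true, one_mul]
    congr 1
    push_cast
    field_simp
    simp
  · intro j _ hj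
    rw [if_neg (fun hc => hj (Fin.ext hc)), zero_mul]
  · simp

theorem zDelay_G11 {nF : ℕ} (F : CTSystem nF) {h : ℝ} (hh : 0 < h) {N : ℕ} (hN : 0 < N) (m : ℕ)
    (v : ℕ → Fin N → ℝ) :
    zDelay m (G11 F h N v) = fastLift h N (fun w => delay (m * h) (F.response w)) v := by
  funext k i
  have hN' : (0 : ℝ) < N := by exact_mod_cast hN
  simp only [zDelay, G11, fastLift, lift, sampler, delay]
  -- The delay is `m * N` fast samples, hence `m` whole blocks; all entries of a block pass the
  -- threshold together.
  have e : (m : ℝ) * h = ((m * N : ℕ) : ℝ) * (h / N) := by push_cast; field_simp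
  have iff : (m : ℝ) * h ≤ ((k * N + i : ℕ) : ℝ) * (h / N) ↔ m ≤ k := by
    rw [e, mul_le_mul_iff_left₀ (by positivity), Nat.cast_le]
    constructor
    · intro H
      have : m * N < (k + 1) * N := by have := i.2; rw [add_mul]; omega
      have := lt_of_mul_lt_mul_right this (Nat.zero_le _)
      omega
    · intro H
      exact (Nat.mul_le_mul_right N H).trans (by omega)
  by_cases hm : m ≤ k
  · rw [if_pos hm, if_pos (iff.2 hm)]
    simp only [lift, sampler]
    congr 1
    rw [e, Nat.cast_add, Nat.cast_mul, Nat.cast_sub hm]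
    push_cast
    ring
  · rw [if_neg hm, if_neg (fun hc => hm (iff.1 hc))]
    rfl

theorem fastLift_interpError {nF nP nK : ℕ} (F : CTSystem nF) (P : CTSystem nP)
    (K : DTSystem nK 1 1) {L : ℕ} (hL : 0 < L) (m : ℕ) {h : ℝ} (hh : 0 < h) {l : ℕ}
    (hl : 0 < l) (v : ℕ → Fin (L * l) → ℝ) :
    zDelay m (G11 F h (L * l) v) + G12 P h L l (liftedFilter K L (G21 F h (L * l) v)) =
      fastLift h (L * l) (interpError F P K L m h) v := by
  rw [zDelay_G11 F hh (Nat.mul_pos hL hl), G21_eq F h (Nat.mul_pos hL hl)]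
  funext k i
  simp only [G12, fastLift, Pi.add_apply, Pi.neg_apply, zoh_unlift_matH hL hl, lift, sampler,
    interpError, scalarResponse_upsample hL]
  ring

/-! ### Markov parameters annihilated by the denominator of the transfer function -/

section Markov

open Polynomial

variable {n : ℕ} (A : Matrix (Fin n) (Fin n) ℝ) (c : Fin n → ℝ)

/-- The polynomial `c adj(X I - A) v`. -/
def adjPoly (v : Fin n → ℝ) : ℝ[X] :=
  (fun i => C (c i)) ⬝ᵥ (A.charmatrix.adjugate *ᵥ fun i => C (v i))

/-- This is `adj(X I - A) (X I - A) = χ I` applied to `v`: modulo the characteristic polynomial `χ`,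
multiplication by `X` acts as `A` on the argument. -/
theorem X_mul_adjPoly (v : Fin n → ℝ) :
    X * adjPoly A c v = adjPoly A c (A *ᵥ v) + A.charpoly * C (c ⬝ᵥ v) := by
  have h1 : A.charmatrix *ᵥ (fun i => C (v i)) =
      (X : ℝ[X]) • (fun i => C (v i)) - fun i => C ((A *ᵥ v) i) := by
    rw [Matrix.charmatrix, Matrix.sub_mulVec]
    congr 1
    · ext1 i
      simp [Matrix.mulVec, dotProduct, Matrix.scalar_apply, Matrix.diagonal_apply]
    · ext1 i
      simp [Matrix.mulVec, dotProduct]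
  have h2 : A.charmatrix.adjugate *ᵥ (A.charmatrix *ᵥ (fun i => C (v i))) =
      A.charpoly • (fun i => C (v i)) := by
    rw [Matrix.mulVec_mulVec, Matrix.adjugate_mul, Matrix.smul_mulVec, Matrix.one_mulVec]
    rfl
  have h3 := congrArg (fun w => (fun i => C (c i)) ⬝ᵥ w) h2
  simp only [h1, Matrix.mulVec_sub, Matrix.mulVec_smul, dotProduct_sub, dotProduct_smul,
    smul_eq_mul] at h3
  have h4 : (fun i => C (c i)) ⬝ᵥ (fun i => C (v i)) = C (c ⬝ᵥ v) := by
    simp [dotProduct, map_sum]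
  rw [h4] at h3
  rw [← h3, adjPoly, adjPoly]
  ring

theorem adjPoly_add (v w : Fin n → ℝ) :
    adjPoly A c (v + w) = adjPoly A c v + adjPoly A c w := by
  simp only [adjPoly, Pi.add_apply, map_add]
  rw [← dotProduct_add, ← Matrix.mulVec_add]
  rfl

theorem adjPoly_smul (a : ℝ) (v : Fin n → ℝ) :
    adjPoly A c (a • v) = C a * adjPoly A c v := by
  simp only [adjPoly, Pi.smul_apply, smul_eq_mul, map_mul]
  rw [← smul_eq_mul (C a), ← dotProduct_smul, ← Matrix.mulVec_smul]
  rfl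

theorem exists_natDegree_adjPoly_le : ∃ d, ∀ v, (adjPoly A c v).natDegree ≤ d := by
  refine ⟨∑ i, (adjPoly A c (Pi.single i 1)).natDegree, fun v => ?_⟩
  have : adjPoly A c v = ∑ i, C (v i) * adjPoly A c (Pi.single i 1) := by
    let f : (Fin n → ℝ) →ₗ[ℝ] ℝ[X] :=
      ⟨⟨adjPoly A c, adjPoly_add A c⟩, fun a v => by
        simp [adjPoly_smul, Polynomial.smul_eq_C_mul]⟩
    refine (LinearMap.pi_apply_eq_sum_univ f v).trans (Finset.sum_congr rfl fun i _ => ?_)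
    rw [Polynomial.smul_eq_C_mul]
    congr 1
    show adjPoly A c _ = adjPoly A c _
    congr 1
    ext j
    simp [Pi.single_apply, eq_comm]
  rw [this]
  refine natDegree_sum_le_of_forall_le _ _ fun i _ => ?_
  refine (natDegree_C_mul_le _ _).trans ?_
  exact Finset.single_le_sum (f := fun i => (adjPoly A c (Pi.single i 1)).natDegree)
    (fun _ _ => Nat.zero_le _) (Finset.mem_univ i)

/-- Descent on a degree bound uniform in `v`: in `X_mul_adjPoly` the left side has one degree more
than `adjPoly A c v`, so a bound valid for all vectors improves by one until `n` stops it. -/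
theorem degree_adjPoly_lt (v : Fin n → ℝ) :
    (adjPoly A c v).degree < A.charpoly.degree := by
  obtain ⟨d, hd⟩ := exists_natDegree_adjPoly_le A c
  have key : ∀ k, (∀ v, adjPoly A c v = 0 ∨ (adjPoly A c v).natDegree + 1 ≤ max k n) →
      ∀ v, adjPoly A c v = 0 ∨ (adjPoly A c v).natDegree + 1 ≤ n := by
    intro k
    induction k with
    | zero => intro h; simpa using h
    | succ k ih =>
      refine fun h => ih fun v => ?_
      by_cases h0 : adjPoly A c v = 0
      · exact Or.inl h0
      refine Or.inr ?_
      rw [← natDegree_X_mul h0, X_mul_adjPoly]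
      refine (natDegree_add_le _ _).trans (max_le ?_ ?_)
      · rcases h (A *ᵥ v) with h' | h'
        · simp [h']
        · omega
      · refine (natDegree_mul_C_le _ _).trans ?_
        rw [Matrix.charpoly_natDegree_eq_dim, Fintype.card_fin]
        exact le_max_right _ _
  rw [Matrix.charpoly_degree_eq_dim, Fintype.card_fin]
  rcases key (d + 1) (fun v => Or.inr (by have := hd v; omega)) v with h | h
  · rw [h, degree_zero]; exact WithBot.bot_lt_coe _
  · exact degree_le_natDegree.trans_lt (by exact_mod_cast h)

theorem charpoly_dvd_adjPoly_aeval (p : ℝ[X]) : ∀ v,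
    A.charpoly ∣ p * adjPoly A c v - adjPoly A c (aeval A p *ᵥ v) := by
  induction p using Polynomial.induction_on with
  | C a =>
    intro v
    have : aeval A (C a) *ᵥ v = a • v := by
      rw [aeval_C, Matrix.algebraMap_eq_diagonal]
      ext i; simp [Matrix.mulVec_diagonal]
    rw [this, adjPoly_smul, sub_self]
    exact dvd_zero _
  | add p q hp hq =>
    intro v
    have := dvd_add (hp v) (hq v)
    rw [map_add, Matrix.add_mulVec, adjPoly_add]
    convert this using 1
    ring
  | monomial k a ih =>
    intro v
    have h1 := ih (A *ᵥ v)
    have h2 : aeval A (C a * X ^ (k + 1)) *ᵥ v = aeval A (C a * X ^ k) *ᵥ (A *ᵥ v) := by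
      rw [pow_succ, ← mul_assoc, map_mul (aeval A) _ X, aeval_X, Matrix.mulVec_mulVec]
    rw [h2]
    have h3 : C a * X ^ (k + 1) * adjPoly A c v =
        C a * X ^ k * adjPoly A c (A *ᵥ v) + A.charpoly * (C a * X ^ k * C (c ⬝ᵥ v)) := by
      rw [pow_succ, ← mul_assoc, mul_assoc _ X, X_mul_adjPoly]; ring
    rw [h3, add_sub_right_comm]
    exact dvd_add h1 (dvd_mul_right _ _)

/-- If the polynomial of `v` vanishes, then `χ` divides that of `A *ᵥ v`, which has smaller degree
and so vanishes too. What remains of `X_mul_adjPoly` is `χ * C (c ⬝ᵥ v) = 0`; then iterate. -/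
theorem dotProduct_pow_mulVec_eq_zero (k : ℕ) : ∀ v, adjPoly A c v = 0 →
    c ⬝ᵥ (A ^ k *ᵥ v) = 0 := by
  have step : ∀ v, adjPoly A c v = 0 → c ⬝ᵥ v = 0 ∧ adjPoly A c (A *ᵥ v) = 0 := by
    intro v hv
    have h := X_mul_adjPoly A c v
    rw [hv, mul_zero] at h
    have hd : A.charpoly ∣ adjPoly A c (A *ᵥ v) :=
      (dvd_add_left (dvd_mul_right _ _)).1 (h ▸ dvd_zero _)
    have h0 := eq_zero_of_dvd_of_degree_lt hd (degree_adjPoly_lt A c _)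
    refine ⟨?_, h0⟩
    rw [h0, zero_add, eq_comm, mul_eq_zero, C_eq_zero] at h
    exact h.resolve_left A.charpoly_monic.ne_zero
  induction k with
  | zero => intro v hv; simpa using (step v hv).1
  | succ k ih =>
    intro v hv
    rw [pow_succ, ← Matrix.mulVec_mulVec]
    exact ih _ (step v hv).2

end Markov

/-! ### The reduced denominator annihilates the Markov parameters -/

namespace CTSystem

open Polynomial

variable {n : ℕ} (G : CTSystem n)

theorem transfer_eq : G.transfer =
    algebraMap ℝ[X] (RatFunc ℝ) (adjPoly G.A G.C G.B) /
      algebraMap ℝ[X] (RatFunc ℝ) G.A.charpoly + RatFunc.C G.D := by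
  have h1 : (RatFunc.X : RatFunc ℝ) • (1 : Matrix (Fin n) (Fin n) (RatFunc ℝ)) -
      G.A.map RatFunc.C = (algebraMap ℝ[X] (RatFunc ℝ)).mapMatrix G.A.charmatrix := by
    ext i j
    by_cases hij : i = j
    · subst hij; simp
    · simp [hij]
  have h2 : ((algebraMap ℝ[X] (RatFunc ℝ)).mapMatrix G.A.charmatrix)⁻¹ =
      (algebraMap ℝ[X] (RatFunc ℝ) G.A.charpoly)⁻¹ •
        (algebraMap ℝ[X] (RatFunc ℝ)).mapMatrix G.A.charmatrix.adjugate := by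
    rw [Matrix.inv_def, ← RingHom.map_det, ← RingHom.map_adjugate, Ring.inverse_eq_inv']
    rfl
  rw [transfer, h1, h2, Matrix.smul_mulVec, dotProduct_smul, smul_eq_mul, div_eq_inv_mul]
  congr 2
  rw [adjPoly]
  simp only [dotProduct, Matrix.mulVec, map_sum, map_mul, RingHom.mapMatrix_apply,
    Matrix.map_apply, RatFunc.algebraMap_C]

/-- Cross-multiplying `num / denom = adjPoly / χ + D` exhibits the cofactor `num - D * denom`.
Cancelled modes cause no trouble, because only divisibility is asserted. -/
theorem charpoly_dvd_denom_mul :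
    G.A.charpoly ∣ G.transfer.denom * adjPoly G.A G.C G.B := by
  have hχ : algebraMap ℝ[X] (RatFunc ℝ) G.A.charpoly ≠ 0 := by
    simpa using G.A.charpoly_monic.ne_zero
  have hp : algebraMap ℝ[X] (RatFunc ℝ) G.transfer.denom ≠ 0 := by
    simpa using RatFunc.denom_ne_zero _
  have h := G.transfer_eq
  conv_lhs at h => rw [← RatFunc.num_div_denom G.transfer]
  rw [← RatFunc.algebraMap_C, div_add' _ _ _ hχ, div_eq_div_iff hp hχ, ← map_mul, ← map_mul,
    ← map_add, ← map_mul] at h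
  have h' := RatFunc.algebraMap_injective ℝ h
  have : G.transfer.denom * adjPoly G.A G.C G.B =
      G.A.charpoly * (G.transfer.num - Polynomial.C G.D * G.transfer.denom) := by
    linear_combination (-1 : ℝ[X]) * h'
  exact this ▸ dvd_mul_right _ _

/-- The Markov parameters of `G` satisfy the recursion given by the denominator. -/
theorem markov_aeval_denom (k : ℕ) :
    G.C ⬝ᵥ (G.A ^ k *ᵥ (aeval G.A G.transfer.denom *ᵥ G.B)) = 0 := by
  apply dotProduct_pow_mulVec_eq_zero
  refine eq_zero_of_dvd_of_degree_lt ?_ (degree_adjPoly_lt G.A G.C _)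
  have h := charpoly_dvd_adjPoly_aeval G.A G.C G.transfer.denom G.B
  exact (dvd_sub_right G.charpoly_dvd_denom_mul).1 h

end CTSystem

/-! ### Exponential decay of stable impulse responses -/

section MatrixExp

attribute [local instance] Matrix.linftyOpNormedRing Matrix.linftyOpNormedAlgebra

variable {𝕜 : Type} [RCLike 𝕜] {n : ℕ}

theorem hasDerivAt_dotProduct_exp (A : Matrix (Fin n) (Fin n) 𝕜) (c b : Fin n → 𝕜) (t : ℝ) :
    HasDerivAt (fun t : ℝ => c ⬝ᵥ (NormedSpace.exp (t • A) *ᵥ b))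
      (c ⬝ᵥ (NormedSpace.exp (t • A) *ᵥ (A *ᵥ b))) t := by
  let φ : Matrix (Fin n) (Fin n) 𝕜 →ₗ[ℝ] 𝕜 :=
    { toFun := fun M => c ⬝ᵥ (M *ᵥ b)
      map_add' := fun M M' => by rw [Matrix.add_mulVec, dotProduct_add]
      map_smul' := fun r M => by rw [Matrix.smul_mulVec, dotProduct_smul]; rfl }
  have h := (LinearMap.toContinuousLinearMap φ).hasFDerivAt.comp_hasDerivAt t
    (hasDerivAt_exp_smul_const (𝕂 := ℝ) A t)
  refine HasDerivAt.congr_deriv (f := fun t : ℝ => c ⬝ᵥ (NormedSpace.exp (t • A) *ᵥ b)) h ?_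
  show c ⬝ᵥ ((NormedSpace.exp (t • A) * A) *ᵥ b) = _
  rw [Matrix.mulVec_mulVec]

theorem dotProduct_exp_eq_zero {A : Matrix (Fin n) (Fin n) ℝ} {c b : Fin n → ℝ}
    (h : ∀ k : ℕ, c ⬝ᵥ (A ^ k *ᵥ b) = 0) (t : ℝ) :
    c ⬝ᵥ (NormedSpace.exp (t • A) *ᵥ b) = 0 := by
  let φ : Matrix (Fin n) (Fin n) ℝ →ₗ[ℝ] ℝ :=
    { toFun := fun M => c ⬝ᵥ (M *ᵥ b)
      map_add' := fun M M' => by rw [Matrix.add_mulVec, dotProduct_add]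
      map_smul' := fun r M => by rw [Matrix.smul_mulVec, dotProduct_smul]; rfl }
  have hs := (LinearMap.toContinuousLinearMap φ).hasSum
    (NormedSpace.exp_series_hasSum_exp' (𝕂 := ℝ) (t • A))
  have hz : ∀ k : ℕ, φ ((k.factorial : ℝ)⁻¹ • (t • A) ^ k) = 0 := by
    intro k
    have : φ (A ^ k) = 0 := h k
    rw [smul_pow, map_smul, map_smul, this, smul_zero, smul_zero]
  exact hs.unique ((hasSum_zero).congr_fun hz)

theorem exp_map_ofReal (A : Matrix (Fin n) (Fin n) ℝ) (t : ℝ) :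
    NormedSpace.exp (t • A.map (Complex.ofReal)) =
      (NormedSpace.exp (t • A)).map Complex.ofReal := by
  have := NormedSpace.map_exp (Complex.ofRealHom.mapMatrix (m := Fin n))
    (continuous_id.matrix_map Complex.continuous_ofReal) (t • A)
  rw [RingHom.mapMatrix_apply] at this
  refine Eq.trans ?_ this.symm
  congr 1
  ext i j
  simp

end MatrixExp

/-- Exponential decay on `[0, ∞)`. -/
def ExpDecay {E : Type} [Norm E] (g : ℝ → E) : Prop :=
  ∃ a > 0, ∃ M ≥ 0, ∀ t : ℝ, 0 ≤ t → ‖g t‖ ≤ M * Real.exp (-a * t)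

/-- With the integrating factor `e^{-zt}` the derivative becomes `e^{-zt} r t`, whose norm is
dominated by an explicitly integrable exponential. -/
theorem ExpDecay.of_hasDerivAt {g r : ℝ → ℂ} {z : ℂ} (hz : z.re < 0)
    (hg : ∀ t, HasDerivAt g (z * g t + r t) t) (hr : ExpDecay r) : ExpDecay g := by
  obtain ⟨a, ha, M, hM, hrM⟩ := hr
  set μ := -z.re with hμ
  have hμ0 : 0 < μ := by linarith
  -- Halving keeps `b` strictly below `μ`, so the resonant case `a = μ` needs no polynomial factor
  -- and `μ - b` can be a denominator.
  set b := min a μ / 2 with hb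
  have hb0 : 0 < b := by positivity
  have hba : b ≤ a := by have := min_le_left a μ; linarith
  have hbμ : b < μ := by
    have := min_le_right a μ
    have : 0 < min a μ := by positivity
    linarith
  refine ⟨b, hb0, ‖g 0‖ + M / (μ - b), by have : 0 < μ - b := by linarith
                                          positivity, fun t ht => ?_⟩
  have hμb : 0 < μ - b := by linarith
  have hnorm : ∀ s : ℝ, ‖Complex.exp (-z * s)‖ = Real.exp (μ * s) := by
    intro s; rw [Complex.norm_exp]; congr 1; simp [hμ]
  have hd : ∀ s : ℝ, HasDerivAt (fun s : ℝ => Complex.exp (-z * s) * g s)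
      (Complex.exp (-z * s) * r s) s := by
    intro s
    have h1 : HasDerivAt (fun s : ℝ => Complex.exp (-z * s))
        (Complex.exp (-z * s) * (-z)) s := by
      have : HasDerivAt (fun s : ℝ => -z * (s : ℂ)) (-z) s := by
        simpa using (Complex.ofRealCLM.hasDerivAt (x := s)).const_mul (-z)
      exact this.cexp
    refine HasDerivAt.congr_deriv (h1.mul (hg s)) ?_
    ring
  have hB : ∀ s : ℝ, HasDerivAt
      (fun s : ℝ => ‖g 0‖ + M / (μ - b) * (Real.exp ((μ - b) * s)))
      (M * Real.exp ((μ - b) * s)) s := by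
    intro s
    have : HasDerivAt (fun s : ℝ => Real.exp ((μ - b) * s))
        (Real.exp ((μ - b) * s) * (μ - b)) s := by
      have h0 : HasDerivAt (fun s : ℝ => (μ - b) * s) (μ - b) s := by
        simpa using (hasDerivAt_id s).const_mul (μ - b)
      exact h0.exp
    refine HasDerivAt.congr_deriv ((this.const_mul (M / (μ - b))).const_add ‖g 0‖) ?_
    field_simp
  have key := image_norm_le_of_norm_deriv_right_le_deriv_boundary (a := 0) (b := t)
    (fun s _ => (hd s).continuousAt.continuousWithinAt)
    (fun s _ => (hd s).hasDerivWithinAt) (B := fun s : ℝ =>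
      ‖g 0‖ + M / (μ - b) * (Real.exp ((μ - b) * s)))
    (by simp; positivity) hB (fun s hs => by
      rw [norm_mul, hnorm]
      calc Real.exp (μ * s) * ‖r s‖ ≤ Real.exp (μ * s) * (M * Real.exp (-a * s)) := by
            gcongr; exact hrM s hs.1
        _ ≤ Real.exp (μ * s) * (M * Real.exp (-b * s)) := by
            have := mul_le_mul_of_nonneg_right hba hs.1
            refine mul_le_mul_of_nonneg_left (mul_le_mul_of_nonneg_left
              (Real.exp_le_exp.2 ?_) hM) (Real.exp_pos _).le
            linarith
        _ = M * Real.exp ((μ - b) * s) := by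
            rw [mul_left_comm, ← Real.exp_add]; ring_nf)
    ⟨ht, le_rfl⟩
  simp only [norm_mul, hnorm] at key
  have h1 : ‖g t‖ = Real.exp (-μ * t) * (Real.exp (μ * t) * ‖g t‖) := by
    rw [← mul_assoc, ← Real.exp_add]; simp
  rw [h1]
  have h2 : ‖g 0‖ + M / (μ - b) * Real.exp ((μ - b) * t) ≤
      (‖g 0‖ + M / (μ - b)) * Real.exp ((μ - b) * t) := by
    rw [add_mul]
    gcongr
    exact le_mul_of_one_le_right (norm_nonneg _) (Real.one_le_exp (by positivity))
  calc _ ≤ Real.exp (-μ * t) * ((‖g 0‖ + M / (μ - b)) * Real.exp ((μ - b) * t)) := by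
        exact mul_le_mul_of_nonneg_left (key.trans h2) (Real.exp_pos _).le
    _ = _ := by rw [mul_left_comm, ← Real.exp_add]; ring_nf

open Polynomial in
-- Write `q = (X - z) p` and `g_b t = c e^{tA} b`. Induction, applied to `p` and the vector `(A - z)
-- b`, gives decay of `g_{(A - z) b} = g_b' - z g_b`, and the scalar equation returns decay of
-- `g_b`. The eigenvalues of `A` play no role.
theorem expDecay_of_aeval {n : ℕ} (A : Matrix (Fin n) (Fin n) ℂ) (c : Fin n → ℂ) (d : ℕ) :
    ∀ (q : ℂ[X]), q.natDegree = d → q ≠ 0 → (∀ z, q.IsRoot z → z.re < 0) → ∀ b : Fin n → ℂ,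
      ExpDecay (fun t : ℝ => c ⬝ᵥ (NormedSpace.exp (t • A) *ᵥ (aeval A q *ᵥ b))) →
      ExpDecay (fun t : ℝ => c ⬝ᵥ (NormedSpace.exp (t • A) *ᵥ b)) := by
  induction d with
  | zero =>
    intro q hq hq0 _ b h
    obtain ⟨a, rfl⟩ := natDegree_eq_zero.1 hq
    have ha : a ≠ 0 := by simpa using hq0
    have hsm : aeval A (C a) *ᵥ b = a • b := by
      rw [aeval_C, Matrix.algebraMap_eq_diagonal]
      ext i; simp [Matrix.mulVec_diagonal]
    simp only [hsm, Matrix.mulVec_smul, dotProduct_smul] at h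
    obtain ⟨r, hr, M, hM, hb⟩ := h
    refine ⟨r, hr, ‖a‖⁻¹ * M, by positivity, fun t ht => ?_⟩
    have := hb t ht
    rw [norm_smul] at this
    rw [mul_assoc, ← div_eq_inv_mul, le_div_iff₀ (norm_pos_iff.2 ha), mul_comm]
    exact this
  | succ d ih =>
    intro q hq hq0 hroot b h
    obtain ⟨z, hz⟩ := IsAlgClosed.exists_root q (by
      rw [degree_eq_natDegree hq0, hq]; exact_mod_cast Nat.succ_ne_zero d)
    obtain ⟨p, rfl⟩ := dvd_iff_isRoot.2 hz
    have hp0 : p ≠ 0 := right_ne_zero_of_mul hq0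
    have hzre := hroot z hz
    have hpd : p.natDegree = d := by
      rw [natDegree_mul (X_sub_C_ne_zero z) hp0, natDegree_X_sub_C] at hq
      omega
    have hfac : aeval A ((X - C z) * p) *ᵥ b = aeval A p *ᵥ (A *ᵥ b - z • b) := by
      rw [mul_comm, map_mul, ← Matrix.mulVec_mulVec]
      congr 1
      rw [map_sub, aeval_X, aeval_C, Matrix.sub_mulVec, Matrix.algebraMap_eq_diagonal]
      congr 1
      ext i; simp [Matrix.mulVec_diagonal]
    rw [hfac] at h
    have h2 := ih p hpd hp0 (fun w hw => hroot w (by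
      rw [IsRoot, eval_mul, hw.eq_zero, mul_zero])) _ h
    refine ExpDecay.of_hasDerivAt hzre (fun t => ?_) h2
    refine HasDerivAt.congr_deriv (hasDerivAt_dotProduct_exp A c b t) ?_
    rw [Matrix.mulVec_sub, Matrix.mulVec_smul, dotProduct_sub, dotProduct_smul, smul_eq_mul]
    ring

/-! ### Decay of the impulse response and its derivative -/

namespace CTSystem

variable {n : ℕ} (G : CTSystem n)

/-- The strictly proper part of the impulse response. -/
def kernel (t : ℝ) : ℝ := G.C ⬝ᵥ (NormedSpace.exp (t • G.A) *ᵥ G.B)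

/-- The derivative of the impulse response. -/
def kernel' (t : ℝ) : ℝ := G.C ⬝ᵥ (NormedSpace.exp (t • G.A) *ᵥ (G.A *ᵥ G.B))

theorem hasDerivAt_kernel (t : ℝ) : HasDerivAt G.kernel (G.kernel' t) t :=
  hasDerivAt_dotProduct_exp G.A G.C G.B t

variable {G}

open Polynomial in
-- The denominator evaluated at `A` produces the zero response, which decays trivially;
-- `expDecay_of_aeval` over `ℂ` removes its roots. The cases `j = 0, 1` give the kernel and its
-- derivative.
theorem IsStable.expDecay (hG : G.IsStable) (j : ℕ) :
    ExpDecay (fun t : ℝ => G.C ⬝ᵥ (NormedSpace.exp (t • G.A) *ᵥ (G.A ^ j *ᵥ G.B))) := by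
  set p := G.transfer.denom with hp
  have hzero : ∀ t : ℝ, G.C ⬝ᵥ (NormedSpace.exp (t • G.A) *ᵥ
      (aeval G.A p *ᵥ (G.A ^ j *ᵥ G.B))) = 0 := by
    refine dotProduct_exp_eq_zero fun k => ?_
    have hc : aeval G.A p * G.A ^ j = G.A ^ j * aeval G.A p := by
      have : G.A ^ j = aeval G.A (X ^ j : ℝ[X]) := by simp
      rw [this, ← map_mul, ← map_mul, mul_comm]
    rw [Matrix.mulVec_mulVec _ (aeval G.A p), hc, ← Matrix.mulVec_mulVec, Matrix.mulVec_mulVec _ (G.A ^ k),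
      ← pow_add]
    exact G.markov_aeval_denom _
  have hre : ∀ (b : Fin n → ℝ) (t : ℝ),
      (fun i => (G.C i : ℂ)) ⬝ᵥ (NormedSpace.exp (t • G.A.map Complex.ofReal) *ᵥ
        fun i => (b i : ℂ)) = ((G.C ⬝ᵥ (NormedSpace.exp (t • G.A) *ᵥ b) : ℝ) : ℂ) := by
    intro b t
    rw [exp_map_ofReal]
    simp [dotProduct, Matrix.mulVec]
  have hq0 : p.map (algebraMap ℝ ℂ) ≠ 0 := by
    rw [Ne, Polynomial.map_eq_zero]; exact RatFunc.denom_ne_zero _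
  have haev : aeval (G.A.map Complex.ofReal) (p.map (algebraMap ℝ ℂ)) =
      (aeval G.A p).map Complex.ofReal := by
    have h1 : ∀ q : ℝ[X], aeval (G.A.map Complex.ofReal) (q.map (algebraMap ℝ ℂ)) =
      (aeval G.A q).map Complex.ofReal := by
      intro q
      rw [aeval_map_algebraMap]
      exact (aeval_algHom_apply (Complex.ofRealAm.mapMatrix (m := Fin n)) G.A q)
    exact h1 p
  have h := expDecay_of_aeval (G.A.map Complex.ofReal) (fun i => (G.C i : ℂ)) _
    (p.map (algebraMap ℝ ℂ)) rfl hq0 (fun z hz => hG z (by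
      rw [IsRoot, eval_map_algebraMap] at hz; exact hz))
    (fun i => ((G.A ^ j *ᵥ G.B) i : ℂ)) (by
      refine ⟨1, one_pos, 0, le_rfl, fun t _ => ?_⟩
      have h2 : aeval (G.A.map Complex.ofReal) (p.map (algebraMap ℝ ℂ)) *ᵥ
          (fun i => ((G.A ^ j *ᵥ G.B) i : ℂ)) =
          fun i => ((aeval G.A p *ᵥ (G.A ^ j *ᵥ G.B)) i : ℂ) := by
        rw [haev]
        ext i
        simp [dotProduct, Matrix.mulVec]
      simp only [h2, hre, hzero]
      simp)
  simp only [hre] at h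
  obtain ⟨a, ha, M, hM, hb⟩ := h
  exact ⟨a, ha, M, hM, fun t ht => by simpa using hb t ht⟩

/-- Common exponential bound for the impulse response and its derivative. -/
theorem IsStable.exists_kernel_bound (hG : G.IsStable) : ∃ a > 0, ∃ M ≥ 0, ∀ t : ℝ, 0 ≤ t →
    |G.kernel t| ≤ M * Real.exp (-a * t) ∧ |G.kernel' t| ≤ M * Real.exp (-a * t) := by
  obtain ⟨a, ha, M, hM, h0⟩ := hG.expDecay 0
  obtain ⟨a', ha', M', hM', h1⟩ := hG.expDecay 1
  simp only [pow_zero, pow_one, Matrix.one_mulVec] at h0 h1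
  refine ⟨min a a', lt_min ha ha', max M M', le_max_of_le_left hM, fun t ht => ⟨?_, ?_⟩⟩
  · refine (h0 t ht).trans ?_
    gcongr
    · exact le_max_left _ _
    · exact min_le_left _ _
  · refine (h1 t ht).trans ?_
    gcongr
    · exact le_max_right _ _
    · exact min_le_right _ _

end CTSystem

/-! ### The state of a continuous-time system -/

section MatrixExp

attribute [local instance] Matrix.linftyOpNormedRing Matrix.linftyOpNormedAlgebra

variable {n : ℕ}

theorem exp_add_smul (A : Matrix (Fin n) (Fin n) ℝ) (s t : ℝ) :
    NormedSpace.exp ((s + t) • A) = NormedSpace.exp (s • A) * NormedSpace.exp (t • A) := by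
  rw [add_smul, Matrix.exp_add_of_commute]
  exact ((Commute.refl A).smul_left s).smul_right t

theorem continuous_exp_smul (A : Matrix (Fin n) (Fin n) ℝ) :
    Continuous (fun t : ℝ => NormedSpace.exp (t • A)) :=
  continuous_iff_continuousAt.2 fun t =>
    (hasDerivAt_exp_smul_const (𝕂 := ℝ) A t).continuousAt

end MatrixExp

theorem continuous_exp_mulVec {n : ℕ} (A : Matrix (Fin n) (Fin n) ℝ) (b : Fin n → ℝ) :
    Continuous (fun t : ℝ => NormedSpace.exp (t • A) *ᵥ b) :=
  (continuous_exp_smul A).matrix_mulVec continuous_const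

namespace CTSystem

variable {n : ℕ} (G : CTSystem n)

theorem continuous_kernel : Continuous G.kernel :=
  continuous_const.dotProduct (continuous_exp_mulVec G.A G.B)

/-- The state trajectory, from zero initial state, driven by `u`. -/
def state (u : ℝ → ℝ) (t : ℝ) : Fin n → ℝ :=
  NormedSpace.exp (t • G.A) *ᵥ ∫ τ in (0 : ℝ)..t, u τ • (NormedSpace.exp ((-τ) • G.A) *ᵥ G.B)

/-- The accumulated input of a unit constant signal over a time `θ`. -/
def stepState (θ : ℝ) : Fin n → ℝ := ∫ s in (0 : ℝ)..θ, NormedSpace.exp (s • G.A) *ᵥ G.B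

variable {u : ℝ → ℝ}

theorem intervalIntegrable_smul_exp (hu : ∀ a b, IntervalIntegrable u volume a b) (a b : ℝ) :
    IntervalIntegrable (fun τ => u τ • (NormedSpace.exp ((-τ) • G.A) *ᵥ G.B)) volume a b :=
  (hu a b).smul_continuousOn
    ((continuous_exp_mulVec G.A G.B).comp continuous_neg).continuousOn

theorem continuous_state (hu : ∀ a b, IntervalIntegrable u volume a b) :
    Continuous (G.state u) :=
  (continuous_exp_smul G.A).matrix_mulVec
    (intervalIntegral.continuous_primitive (G.intervalIntegrable_smul_exp hu) 0)

theorem mulVec_intervalIntegral {p q : ℕ} (M : Matrix (Fin p) (Fin q) ℝ) {f : ℝ → Fin q → ℝ}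
    {a b : ℝ} (hf : IntervalIntegrable f volume a b) :
    M *ᵥ ∫ τ in a..b, f τ = ∫ τ in a..b, M *ᵥ f τ :=
  ((LinearMap.toContinuousLinearMap M.mulVecLin).intervalIntegral_comp_comm hf).symm

theorem dotProduct_intervalIntegral {q : ℕ} (c : Fin q → ℝ) {f : ℝ → Fin q → ℝ}
    {a b : ℝ} (hf : IntervalIntegrable f volume a b) :
    c ⬝ᵥ ∫ τ in a..b, f τ = ∫ τ in a..b, c ⬝ᵥ f τ :=
  ((LinearMap.toContinuousLinearMap
    (dotProductBilin ℝ ℝ c : (Fin q → ℝ) →ₗ[ℝ] ℝ)).intervalIntegral_comp_comm hf).symm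

theorem response_eq_state (hu : ∀ a b, IntervalIntegrable u volume a b) (t : ℝ) :
    G.response u t = G.C ⬝ᵥ G.state u t + G.D * u t := by
  have hi := G.intervalIntegrable_smul_exp hu 0 t
  rw [response, state, mulVec_intervalIntegral _ hi, dotProduct_intervalIntegral]
  · congr 1
    refine intervalIntegral.integral_congr fun τ _ => ?_
    rw [Matrix.mulVec_smul, dotProduct_smul, Matrix.mulVec_mulVec, ← exp_add_smul, smul_eq_mul,
      mul_comm, sub_eq_add_neg]
  · simp only [Matrix.mulVec_smul]
    refine (hu 0 t).smul_continuousOn (Continuous.continuousOn ?_)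
    exact continuous_const.matrix_mulVec
      ((continuous_exp_mulVec G.A G.B).comp continuous_neg)

/-- The state after holding the input constant for a time `θ`. -/
theorem state_add_of_const (hu : ∀ a b, IntervalIntegrable u volume a b) {a θ c : ℝ}
    (hθ : 0 ≤ θ) (hc : ∀ τ ∈ Set.Ioo a (a + θ), u τ = c) :
    G.state u (a + θ) = NormedSpace.exp (θ • G.A) *ᵥ G.state u a + c • G.stepState θ := by
  have hi := G.intervalIntegrable_smul_exp hu
  have h1 : ∫ τ in a..(a + θ), u τ • (NormedSpace.exp ((-τ) • G.A) *ᵥ G.B) =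
      ∫ τ in a..(a + θ), c • (NormedSpace.exp ((-τ) • G.A) *ᵥ G.B) := by
    refine intervalIntegral.integral_congr_ae ?_
    -- A held signal may jump at the right endpoint, which is a null set.
    have : ∀ᵐ τ : ℝ, τ ≠ a + θ := by simp [ae_iff, measure_singleton]
    filter_upwards [this] with τ hτ hmem
    rw [Set.uIoc_of_le (by linarith)] at hmem
    rw [hc τ ⟨hmem.1, lt_of_le_of_ne hmem.2 hτ⟩]
  have h2 : NormedSpace.exp ((a + θ) • G.A) *ᵥ
      ∫ τ in a..(a + θ), c • (NormedSpace.exp ((-τ) • G.A) *ᵥ G.B) = c • G.stepState θ := by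
    rw [intervalIntegral.integral_smul, Matrix.mulVec_smul, mulVec_intervalIntegral, stepState]
    · congr 1
      have h3 := intervalIntegral.integral_comp_sub_left (a := a) (b := a + θ)
        (fun s => NormedSpace.exp (s • G.A) *ᵥ G.B) (a + θ)
      rw [sub_self, add_sub_cancel_left] at h3
      rw [← h3]
      refine intervalIntegral.integral_congr fun τ _ => ?_
      rw [Matrix.mulVec_mulVec, ← exp_add_smul, sub_eq_add_neg]
    · exact ((continuous_exp_mulVec G.A G.B).comp continuous_neg).intervalIntegrable _ _
  rw [state, ← intervalIntegral.integral_add_adjacent_intervals (hi 0 a) (hi a (a + θ)),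
    Matrix.mulVec_add, h1, h2, state, Matrix.mulVec_mulVec, ← exp_add_smul, add_comm a θ]

end CTSystem

/-! ### Zero-order hold signals -/

theorem measurable_zoh (d : ℝ) (v : ℕ → ℝ) : Measurable (zoh d v) := by
  unfold zoh
  refine Measurable.ite measurableSet_Ici ?_ measurable_const
  exact (measurable_from_nat (f := v)).comp
    (Nat.measurable_floor.comp (measurable_id.div_const d))

theorem abs_zoh_le {d : ℝ} (hd : 0 < d) (v : ℕ → ℝ) {t S : ℝ} (ht : t ≤ S) :
    |zoh d v t| ≤ ∑ k ∈ Finset.range (⌊S / d⌋₊ + 1), |v k| := by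
  unfold zoh
  split_ifs with h0
  · refine Finset.single_le_sum (f := fun k => |v k|) (fun _ _ => abs_nonneg _) ?_
    rw [Finset.mem_range, Nat.lt_succ_iff]
    exact Nat.floor_mono (by gcongr)
  · rw [abs_zero]; exact Finset.sum_nonneg fun _ _ => abs_nonneg _

theorem intervalIntegrable_zoh {d : ℝ} (hd : 0 < d) (v : ℕ → ℝ) (a b : ℝ) :
    IntervalIntegrable (zoh d v) volume a b := by
  rw [intervalIntegrable_iff]
  refine Measure.integrableOn_of_bounded (M := ∑ k ∈ Finset.range (⌊max a b / d⌋₊ + 1), |v k|)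
    (by simp [Set.uIoc]) (measurable_zoh d v).aestronglyMeasurable ?_
  refine (ae_restrict_iff' measurableSet_uIoc).2 (ae_of_all _ fun t ht => ?_)
  rw [Real.norm_eq_abs]
  exact abs_zoh_le hd v ht.2

theorem zoh_apply {d : ℝ} (hd : 0 < d) (v : ℕ → ℝ) (k : ℕ) {θ : ℝ} (h0 : 0 ≤ θ) (h1 : θ < d) :
    zoh d v (k * d + θ) = v k := by
  have : ⌊(k * d + θ) / d⌋₊ = k := by
    rw [Nat.floor_eq_iff (by positivity), le_div_iff₀ hd, div_lt_iff₀ hd]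
    constructor <;> nlinarith
  rw [zoh, if_pos (by positivity), this]

theorem zoh_natCast_mul {d : ℝ} (hd : 0 < d) (v : ℕ → ℝ) (k : ℕ) : zoh d v (k * d) = v k := by
  simpa using zoh_apply hd v k le_rfl hd

theorem CTSystem.state_zoh {n : ℕ} (G : CTSystem n) {d : ℝ} (hd : 0 < d) (v : ℕ → ℝ) (k : ℕ)
    {θ : ℝ} (h0 : 0 ≤ θ) (h1 : θ ≤ d) :
    G.state (zoh d v) (k * d + θ) =
      NormedSpace.exp (θ • G.A) *ᵥ G.state (zoh d v) (k * d) + v k • G.stepState θ := by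
  refine G.state_add_of_const (intervalIntegrable_zoh hd v) h0 fun τ hτ => ?_
  have := zoh_apply hd v k (θ := τ - k * d) (by linarith [hτ.1]) (by linarith [hτ.2])
  simpa using this

/-- Step-invariant discretization. -/
theorem realizable_sampled {n : ℕ} (G : CTSystem n) {d : ℝ} (hd : 0 < d) :
    Realizable (fun v => sampler d (G.response (zoh d v))) := by
  refine ⟨Fin n → ℝ, inferInstance, inferInstance, inferInstance,
    (NormedSpace.exp (d • G.A)).mulVecLin, LinearMap.toSpanSingleton ℝ _ (G.stepState d),
    dotProductBilin ℝ ℝ G.C, LinearMap.toSpanSingleton ℝ _ G.D, fun v => ?_⟩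
  refine ⟨fun k => G.state (zoh d v) (k * d), by simp [CTSystem.state], fun k => ⟨?_, ?_⟩⟩
  · have := G.state_zoh hd v k hd.le le_rfl
    rw [show (k : ℝ) * d + d = ((k + 1 : ℕ) : ℝ) * d by push_cast; ring] at this
    exact this
  · change G.response (zoh d v) (k * d) = _
    rw [G.response_eq_state (intervalIntegrable_zoh hd v), zoh_natCast_mul hd, mul_comm G.D]
    rfl

theorem realizable_fastLift {n : ℕ} (G : CTSystem n) {h : ℝ} (hh : 0 < h) {N : ℕ}
    (hN : 0 < N) : Realizable (fastLift h N G.response) := by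
  have hN' : (0 : ℝ) < N := by exact_mod_cast hN
  exact (realizable_sampled G (div_pos hh hN')).lift_unlift hN

theorem realizable_fastLift_interpError {nF nP nK : ℕ} (F : CTSystem nF) (P : CTSystem nP)
    (K : DTSystem nK 1 1) {L : ℕ} (hL : 0 < L) (m : ℕ) {h : ℝ} (hh : 0 < h) {l : ℕ}
    (hl : 0 < l) : Realizable (fastLift h (L * l) (interpError F P K L m h)) := by
  have hN : 0 < L * l := Nat.mul_pos hL hl
  have e : fastLift h (L * l) (interpError F P K L m h) = fun v =>
      zDelay m (G11 F h (L * l) v) + G12 P h L l (liftedFilter K L (G21 F h (L * l) v)) :=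
    funext fun v => (fastLift_interpError F P K hL m hh hl v).symm
  rw [e]
  refine ((Realizable.zDelay m _).comp (realizable_fastLift F hh hN)).add ?_
  have h12 : Realizable (G12 P h L l) :=
    (Realizable.static (-LinearMap.id)).comp ((realizable_fastLift P hh hN).comp
      (Realizable.static (matH L l).mulVecLin))
  have h21 : Realizable (G21 F h (L * l)) :=
    (Realizable.static (dotProductBilin ℝ ℝ (rowS (L * l)))).comp (realizable_fastLift F hh hN)
  exact h12.comp ((realizable_liftedFilter hL K).comp h21)

/-! ### Norms of signals -/

theorem eLpNorm_two_eq {α : Type} [MeasurableSpace α] (μ : Measure α) (f : α → ℝ) :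
    eLpNorm f 2 μ = (∫⁻ x, ‖f x‖ₑ ^ 2 ∂μ) ^ (1 / 2 : ℝ) := by
  rw [eLpNorm_eq_lintegral_rpow_enorm_toReal (by norm_num) (by norm_num)]
  simp

theorem eLpNorm_two_sq {α : Type} [MeasurableSpace α] (μ : Measure α) (f : α → ℝ) :
    eLpNorm f 2 μ ^ 2 = ∫⁻ x, ‖f x‖ₑ ^ 2 ∂μ := by
  rw [eLpNorm_two_eq, ← ENNReal.rpow_natCast, ← ENNReal.rpow_mul]
  simp

theorem normL2_sq (u : ℝ → ℝ) : normL2 u ^ 2 = ∫⁻ t in Set.Ici 0, ‖u t‖ₑ ^ 2 :=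
  eLpNorm_two_sq _ u

theorem iUnion_Ico_natCast_mul {d : ℝ} (hd : 0 < d) :
    ⋃ k : ℕ, Set.Ico ((k : ℝ) * d) (k * d + d) = Set.Ici 0 := by
  ext t
  simp only [Set.mem_iUnion, Set.mem_Ico, Set.mem_Ici]
  constructor
  · rintro ⟨k, hk, _⟩
    exact le_trans (by positivity) hk
  · intro ht
    refine ⟨⌊t / d⌋₊, ?_, ?_⟩
    · rw [← le_div_iff₀ hd]; exact Nat.floor_le (by positivity)
    · have := Nat.lt_floor_add_one (t / d)
      rw [div_lt_iff₀ hd] at this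
      linarith

theorem lintegral_Ici_eq_tsum {d : ℝ} (hd : 0 < d) (f : ℝ → ℝ≥0∞) :
    ∫⁻ t in Set.Ici 0, f t = ∑' k : ℕ, ∫⁻ θ in Set.Ico 0 d, f (k * d + θ) := by
  rw [← iUnion_Ico_natCast_mul hd, lintegral_iUnion (fun _ => measurableSet_Ico)]
  · congr 1
    ext k
    have h := (measurePreserving_add_left volume ((k : ℝ) * d)).setLIntegral_comp_preimage_emb
      (measurableEmbedding_addLeft _) f (Set.Ico ((k : ℝ) * d) (k * d + d))
    rw [← h]
    congr 2
    simp
  · intro i j hij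
    have key : ∀ i j : ℕ, i < j →
        Disjoint (Set.Ico ((i : ℝ) * d) (i * d + d)) (Set.Ico ((j : ℝ) * d) (j * d + d)) := by
      intro i j h
      refine Set.disjoint_left.2 fun t h1 h2 => ?_
      have h3 : ((i + 1 : ℕ) : ℝ) ≤ j := by exact_mod_cast h
      have h4 := mul_le_mul_of_nonneg_right h3 hd.le
      push_cast at h4
      linarith [h1.2, h2.1]
    rcases lt_or_gt_of_ne hij with h | h
    · exact key i j h
    · exact (key j i h).symm

theorem normL2_zoh_sq {d : ℝ} (hd : 0 < d) (s : ℕ → ℝ) :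
    normL2 (zoh d s) ^ 2 = ENNReal.ofReal d * ∑' k, ‖s k‖ₑ ^ 2 := by
  rw [normL2_sq, lintegral_Ici_eq_tsum hd, ← ENNReal.tsum_mul_left]
  congr 1
  ext k
  have : ∫⁻ θ in Set.Ico 0 d, ‖zoh d s (k * d + θ)‖ₑ ^ 2 =
      ∫⁻ θ in Set.Ico 0 d, ‖s k‖ₑ ^ 2 :=
    setLIntegral_congr_fun measurableSet_Ico fun θ hθ => by
      simp only [zoh_apply hd s k hθ.1 hθ.2]
  rw [this, setLIntegral_const, Real.volume_Ico, sub_zero, mul_comm]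

theorem norml2_lift {N : ℕ} (hN : 0 < N) (s : ℕ → ℝ) :
    norml2 (lift N s) = (∑' k, ‖s k‖ₑ ^ 2) ^ (1 / 2 : ℝ) := by
  have : NeZero N := ⟨hN.ne'⟩
  rw [norml2, ← (Nat.divModEquiv N).symm.tsum_eq (fun k => ‖s k‖ₑ ^ 2), ENNReal.tsum_prod']
  simp only [tsum_fintype, lift, Nat.divModEquiv_symm_apply]

/-- The factor `√d` is the same for input and output and cancels in every gain quotient. -/
theorem normL2_zoh {d : ℝ} (hd : 0 < d) {N : ℕ} (hN : 0 < N) (s : ℕ → ℝ) :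
    normL2 (zoh d s) = ENNReal.ofReal d ^ (1 / 2 : ℝ) * norml2 (lift N s) := by
  rw [norml2_lift hN, ← ENNReal.mul_rpow_of_nonneg _ _ (by norm_num), ← normL2_zoh_sq hd,
    ← ENNReal.rpow_natCast, ← ENNReal.rpow_mul]
  simp

/-- Sampling followed by a zero-order hold. -/
def sampleHold (d : ℝ) (u : ℝ → ℝ) : ℝ → ℝ := zoh d (sampler d u)

theorem sampleHold_apply {d : ℝ} (u : ℝ → ℝ) {t : ℝ} (ht : 0 ≤ t) :
    sampleHold d u t = u (⌊t / d⌋₊ * d) := by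
  rw [sampleHold, zoh, if_pos ht, sampler]

theorem floor_mul_le {d : ℝ} (hd : 0 < d) {t : ℝ} (ht : 0 ≤ t) : ⌊t / d⌋₊ * d ≤ t := by
  rw [← le_div_iff₀ hd]; exact Nat.floor_le (by positivity)

theorem lt_floor_mul_add {d : ℝ} (hd : 0 < d) (t : ℝ) : t < ⌊t / d⌋₊ * d + d := by
  have := Nat.lt_floor_add_one (t / d)
  rw [div_lt_iff₀ hd] at this
  linarith

/-- The induced norm of a fast-lifted operator, in terms of held signals. -/
theorem norml2_fastLift_div {h : ℝ} (hh : 0 < h) {N : ℕ} (hN : 0 < N)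
    (G : (ℝ → ℝ) → (ℝ → ℝ)) (v : ℕ → ℝ) :
    norml2 (fastLift h N G (lift N v)) / norml2 (lift N v) =
      normL2 (sampleHold (h / N) (G (zoh (h / N) v))) / normL2 (zoh (h / N) v) := by
  have hN' : (0 : ℝ) < N := by exact_mod_cast hN
  have hd : 0 < h / N := div_pos hh hN'
  rw [sampleHold, normL2_zoh hd hN, normL2_zoh hd hN, fastLift, unlift_lift hN,
    ENNReal.mul_div_mul_left]
  · simp [hd]
  · simp

theorem normL2_sampleHold_div_le {h : ℝ} (hh : 0 < h) {N : ℕ} (hN : 0 < N)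
    (G : (ℝ → ℝ) → (ℝ → ℝ)) (v : ℕ → ℝ) (h0 : normL2 (zoh (h / N) v) ≠ 0)
    (h1 : normL2 (zoh (h / N) v) ≠ ∞) :
    normL2 (sampleHold (h / N) (G (zoh (h / N) v))) / normL2 (zoh (h / N) v) ≤
      inducedNorml2 (fastLift h N G) := by
  have hN' : (0 : ℝ) < N := by exact_mod_cast hN
  have hd : 0 < h / N := div_pos hh hN'
  rw [← norml2_fastLift_div hh hN]
  rw [normL2_zoh hd hN] at h0 h1
  refine le_iSup_of_le (lift N v) (le_iSup_of_le ?_ (le_iSup_of_le ?_ le_rfl))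
  · intro hc; apply h1; rw [hc]; exact ENNReal.mul_top (by simp [hd])
  · exact right_ne_zero_of_mul h0

theorem inducedNorml2_fastLift_le {h : ℝ} (hh : 0 < h) {N : ℕ} (hN : 0 < N)
    (G : (ℝ → ℝ) → (ℝ → ℝ)) {c : ℝ≥0∞}
    (hc : ∀ v : ℕ → ℝ, normL2 (zoh (h / N) v) ≠ 0 → normL2 (zoh (h / N) v) ≠ ∞ →
      normL2 (sampleHold (h / N) (G (zoh (h / N) v))) / normL2 (zoh (h / N) v) ≤ c) :
    inducedNorml2 (fastLift h N G) ≤ c := by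
  have hN' : (0 : ℝ) < N := by exact_mod_cast hN
  have hd : 0 < h / N := div_pos hh hN'
  refine iSup_le fun w => iSup_le fun h1 => iSup_le fun h0 => ?_
  obtain ⟨v, rfl⟩ : ∃ v, w = lift N v := ⟨unlift N w, (lift_unlift hN w).symm⟩
  rw [norml2_fastLift_div hh hN]
  have := normL2_zoh hd hN v
  refine hc v ?_ ?_
  · rw [this]; exact mul_ne_zero (by simp [hd]) h0
  · rw [this]; exact ENNReal.mul_ne_top (by simp) h1

/-! ### Schur test for convolutions -/

/-- Cauchy–Schwarz for the factorization `k W = √k · (√k W)`. -/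
theorem lintegral_mul_sq_le {α : Type} [MeasurableSpace α] {μ : Measure α} {k W : α → ℝ≥0∞}
    (hk : AEMeasurable k μ) (hW : AEMeasurable W μ) :
    (∫⁻ x, k x * W x ∂μ) ^ 2 ≤ (∫⁻ x, k x ∂μ) * ∫⁻ x, k x * W x ^ 2 ∂μ := by
  have h := ENNReal.lintegral_mul_le_Lp_mul_Lq μ Real.HolderConjugate.two_two
    (f := fun x => k x ^ (1 / 2 : ℝ)) (g := fun x => k x ^ (1 / 2 : ℝ) * W x)
    (hk.pow_const _) ((hk.pow_const _).mul hW)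
  have hkk : ∀ a : ℝ≥0∞, a ^ (1 / 2 : ℝ) * a ^ (1 / 2 : ℝ) = a := fun a => by
    rw [← ENNReal.rpow_add_of_nonneg _ _ (by norm_num) (by norm_num)]; norm_num
  have hk2 : ∀ a : ℝ≥0∞, (a ^ (1 / 2 : ℝ)) ^ (2 : ℝ) = a := fun a => by
    rw [← ENNReal.rpow_mul]; norm_num
  have h2k : ∀ a : ℝ≥0∞, (a ^ (1 / 2 : ℝ)) ^ 2 = a := fun a => by
    rw [sq, hkk]
  simp only [Pi.mul_apply, ENNReal.mul_rpow_of_nonneg _ _ (show (0 : ℝ) ≤ 2 by norm_num),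
    hk2, ← mul_assoc, hkk] at h
  calc _ ≤ _ := pow_le_pow_left' h 2
    _ = _ := by
      rw [mul_pow, h2k, h2k]
      simp [ENNReal.rpow_ofNat]

/-- Young's inequality `‖k * W‖₂ ≤ ‖k‖₁ ‖W‖₂`. -/
theorem lintegral_conv_sq_le {k W : ℝ → ℝ≥0∞} (hk : Measurable k)
    (hk' : ∫⁻ s, k s ≠ ∞) (hW : AEMeasurable W) :
    ∫⁻ t, (∫⁻ τ, k (t - τ) * W τ) ^ 2 ≤ (∫⁻ s, k s) ^ 2 * ∫⁻ τ, W τ ^ 2 := by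
  have hkt : ∀ t, AEMeasurable (fun τ : ℝ => k (t - τ)) := fun t =>
    (hk.comp (measurable_const.sub measurable_id)).aemeasurable
  calc ∫⁻ t, (∫⁻ τ, k (t - τ) * W τ) ^ 2
      ≤ ∫⁻ t, (∫⁻ s, k s) * ∫⁻ τ, k (t - τ) * W τ ^ 2 := by
        refine lintegral_mono fun t => ?_
        refine (lintegral_mul_sq_le (hkt t) hW).trans_eq ?_
        rw [lintegral_sub_left_eq_self]
    _ = (∫⁻ s, k s) * ∫⁻ t, ∫⁻ τ, k (t - τ) * W τ ^ 2 := by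
        exact lintegral_const_mul' _ _ hk'
    _ = (∫⁻ s, k s) * ∫⁻ τ, ∫⁻ t, k (t - τ) * W τ ^ 2 := by
        congr 1
        refine lintegral_lintegral_swap ?_
        refine AEMeasurable.mul ?_ ?_
        · exact (hk.comp (measurable_fst.sub measurable_snd)).aemeasurable
        · exact (hW.comp_quasiMeasurePreserving Measure.quasiMeasurePreserving_snd).pow_const 2
    _ = _ := by
        rw [sq, mul_assoc]
        congr 1
        rw [← lintegral_const_mul'' _ (hW.pow_const 2)]
        refine lintegral_congr fun τ => ?_
        have hm : Measurable fun t => k (t - τ) := hk.comp (measurable_id.sub measurable_const)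
        rw [lintegral_mul_const _ hm,
          lintegral_sub_right_eq_self]

/-! ### Stable strictly proper systems and their sample-and-hold error -/

theorem normL2_delay {d : ℝ} (hd : 0 ≤ d) (g : ℝ → ℝ) : normL2 (delay d g) = normL2 g := by
  have : normL2 (delay d g) ^ 2 = normL2 g ^ 2 := by
    rw [normL2_sq, normL2_sq]
    have h := (measurePreserving_add_left volume d).setLIntegral_comp_preimage_emb
      (measurableEmbedding_addLeft _) (fun t => ‖delay d g t‖ₑ ^ 2) (Set.Ici d)
    have hpre : (fun x => d + x) ⁻¹' Set.Ici d = Set.Ici 0 := by ext; simp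
    rw [hpre] at h
    have h1 : ∫⁻ t in Set.Ici 0, ‖g t‖ₑ ^ 2 = ∫⁻ t in Set.Ici 0, ‖delay d g (d + t)‖ₑ ^ 2 :=
      setLIntegral_congr_fun measurableSet_Ici fun t ht => by
        simp [delay, Set.mem_Ici.1 ht]
    rw [h1, h, ← lintegral_indicator measurableSet_Ici, ← lintegral_indicator measurableSet_Ici]
    refine lintegral_congr fun t => ?_
    by_cases h1 : d ≤ t
    · simp [Set.indicator, h1, hd.trans h1]
    · simp [Set.indicator, h1, delay]
  exact (ENNReal.pow_right_strictMono two_ne_zero).injective this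

theorem normL2_congr {f g : ℝ → ℝ} (h : ∀ t, 0 ≤ t → f t = g t) : normL2 f = normL2 g :=
  eLpNorm_congr_ae ((ae_restrict_iff' measurableSet_Ici).2 (ae_of_all _ h))

theorem floor_sub_natCast_mul {δ : ℝ} (hδ : 0 < δ) (j : ℕ) {t : ℝ} (ht : j * δ ≤ t) :
    (⌊(t - j * δ) / δ⌋₊ : ℝ) * δ = ⌊t / δ⌋₊ * δ - j * δ := by
  have hj : (j : ℝ) ≤ t / δ := by rwa [le_div_iff₀ hδ]
  have h1 : (t - j * δ) / δ = t / δ - j := by field_simp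
  rw [h1, Nat.floor_sub_natCast, Nat.cast_sub (Nat.le_floor hj)]
  ring

/-- A delay by a multiple of the sampling period commutes with sample-and-hold, so the delay does
not affect the error. -/
theorem normL2_sub_sampleHold_delay {δ : ℝ} (hδ : 0 < δ) (j : ℕ) (g : ℝ → ℝ) :
    normL2 (delay (j * δ) g - sampleHold δ (delay (j * δ) g)) = normL2 (g - sampleHold δ g) := by
  rw [← normL2_delay (d := j * δ) (by positivity) (g - sampleHold δ g)]
  refine normL2_congr fun t ht => ?_
  rw [Pi.sub_apply, sampleHold_apply _ ht]
  by_cases h : j * δ ≤ t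
  · have h2 : j * δ ≤ ⌊t / δ⌋₊ * δ := by
      gcongr
      exact Nat.le_floor (by rwa [le_div_iff₀ hδ])
    rw [delay, delay, delay, if_pos h, if_pos h, if_pos h2, Pi.sub_apply,
      sampleHold_apply _ (by linarith), floor_sub_natCast_mul hδ j h]
  · have h2 : ¬ j * δ ≤ ⌊t / δ⌋₊ * δ := fun hc => h (hc.trans (floor_mul_le hδ ht))
    rw [delay, delay, delay, if_neg h, if_neg h, if_neg h2, sub_zero]

/-- The kernel `κ` may depend on `t` and need only be dominated by a convolution kernel:
sample-and-hold destroys time invariance. -/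
theorem normL2_le_of_conv_bound {k : ℝ → ℝ≥0∞} (hk : Measurable k) {C : ℝ≥0∞}
    (hC : ∫⁻ s, k s ≤ C) (hC' : C ≠ ∞) {u g : ℝ → ℝ} (hu : AEStronglyMeasurable u)
    (hg : ∀ t, 0 ≤ t → ∃ κ : ℝ → ℝ, (∀ τ, 0 < τ → τ ≤ t → ‖κ τ‖ₑ ≤ k (t - τ)) ∧
      g t = ∫ τ in (0 : ℝ)..t, κ τ * u τ) :
    normL2 g ≤ C * normL2 u := by
  set W : ℝ → ℝ≥0∞ := (Set.Ici 0).indicator fun τ => ‖u τ‖ₑ with hW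
  have hWm : AEMeasurable W := hu.enorm.indicator measurableSet_Ici
  have hpt : ∀ t, 0 ≤ t → ‖g t‖ₑ ≤ ∫⁻ τ, k (t - τ) * W τ := by
    intro t ht
    obtain ⟨κ, hκ, hgt⟩ := hg t ht
    rw [hgt, intervalIntegral.integral_of_le ht]
    refine (enorm_integral_le_lintegral_enorm _).trans ?_
    rw [← lintegral_indicator measurableSet_Ioc]
    refine lintegral_mono fun τ => ?_
    by_cases hτ : τ ∈ Set.Ioc 0 t
    · rw [Set.indicator_of_mem hτ, enorm_mul, hW,
        Set.indicator_of_mem (Set.mem_Ici.2 hτ.1.le)]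
      gcongr
      exact hκ τ hτ.1 hτ.2
    · rw [Set.indicator_of_notMem hτ]; exact zero_le
  have : normL2 g ^ 2 ≤ (C * normL2 u) ^ 2 := by
    rw [normL2_sq, mul_pow, normL2_sq]
    calc ∫⁻ t in Set.Ici 0, ‖g t‖ₑ ^ 2
        ≤ ∫⁻ t in Set.Ici 0, (∫⁻ τ, k (t - τ) * W τ) ^ 2 :=
          setLIntegral_mono' measurableSet_Ici fun t ht => pow_le_pow_left' (hpt t ht) 2
      _ ≤ ∫⁻ t, (∫⁻ τ, k (t - τ) * W τ) ^ 2 := setLIntegral_le_lintegral _ _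
      _ ≤ (∫⁻ s, k s) ^ 2 * ∫⁻ τ, W τ ^ 2 :=
          lintegral_conv_sq_le hk (hC.trans_lt hC'.lt_top).ne hWm
      _ ≤ C ^ 2 * ∫⁻ t in Set.Ici 0, ‖u t‖ₑ ^ 2 := by
          refine mul_le_mul' (pow_le_pow_left' hC 2) ?_
          rw [← lintegral_indicator measurableSet_Ici]
          refine lintegral_mono fun τ => ?_
          by_cases hτ : τ ∈ Set.Ici (0 : ℝ)
          · simp [hW, Set.indicator_of_mem hτ]
          · simp [hW, Set.indicator_of_notMem hτ]
  exact (ENNReal.pow_right_strictMono two_ne_zero).le_iff_le.1 this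

/-- A one-sided exponential. -/
def expKernel (a : ℝ) : ℝ → ℝ≥0∞ :=
  (Set.Ici 0).indicator fun s => ENNReal.ofReal (Real.exp (-a * s))

theorem measurable_expKernel (a : ℝ) : Measurable (expKernel a) :=
  Measurable.indicator (by fun_prop) measurableSet_Ici

theorem lintegral_expKernel_ne_top {a : ℝ} (ha : 0 < a) : ∫⁻ s, expKernel a s ≠ ∞ := by
  rw [expKernel, lintegral_indicator measurableSet_Ici, setLIntegral_congr Ioi_ae_eq_Ici.symm]
  exact (exp_neg_integrableOn_Ioi 0 ha).lintegral_lt_top.ne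

namespace CTSystem

variable {n : ℕ} {G : CTSystem n}

theorem response_eq_kernel (hD : G.D = 0) (u : ℝ → ℝ) (t : ℝ) :
    G.response u t = ∫ τ in (0 : ℝ)..t, G.kernel (t - τ) * u τ := by
  simp [response, hD, kernel]

/-- A stable strictly proper system is bounded on `L²`. -/
theorem IsStable.exists_normL2_response_le (hG : G.IsStable) (hD : G.D = 0) :
    ∃ C : ℝ≥0∞, C ≠ ∞ ∧ ∀ u : ℝ → ℝ, AEStronglyMeasurable u →
      normL2 (G.response u) ≤ C * normL2 u := by
  obtain ⟨a, ha, M, hM, hb⟩ := hG.exists_kernel_bound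
  refine ⟨ENNReal.ofReal M * ∫⁻ s, expKernel a s,
    ENNReal.mul_ne_top (by simp) (lintegral_expKernel_ne_top ha), fun u hu => ?_⟩
  refine normL2_le_of_conv_bound (k := fun s => ENNReal.ofReal M * expKernel a s)
    ((measurable_expKernel a).const_mul _)
    (lintegral_const_mul _ (measurable_expKernel a)).le
    (ENNReal.mul_ne_top (by simp) (lintegral_expKernel_ne_top ha)) hu fun t _ =>
    ⟨fun τ => G.kernel (t - τ), fun τ _ hτ => ?_, response_eq_kernel hD u t⟩
  have h0 : 0 ≤ t - τ := by linarith
  rw [expKernel, Set.indicator_of_mem (Set.mem_Ici.2 h0), ← ENNReal.ofReal_mul hM,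
    Real.enorm_eq_ofReal_abs]
  exact ENNReal.ofReal_le_ofReal (hb _ h0).1

/-- The sample-and-hold error of a stable strictly proper system is `O(δ)`. -/
theorem IsStable.exists_normL2_sub_sampleHold_le (hG : G.IsStable) (hD : G.D = 0) (h : ℝ) :
    ∃ C : ℝ≥0∞, C ≠ ∞ ∧ ∀ δ : ℝ, 0 < δ → δ ≤ h → ∀ u : ℝ → ℝ,
      (∀ a b, IntervalIntegrable u volume a b) → AEStronglyMeasurable u →
      normL2 (G.response u - sampleHold δ (G.response u)) ≤
        ENNReal.ofReal δ * C * normL2 u := by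
  obtain ⟨a, ha, M, hM, hb⟩ := hG.exists_kernel_bound
  -- The factor `e^{ah}` pays for replacing the sampling instant `s` by `t` in the exponential,
  -- since `t - s < δ ≤ h`.
  set M' := M * Real.exp (a * h) with hM'
  have hM'0 : 0 ≤ M' := by positivity
  set C := ENNReal.ofReal M' * (∫⁻ s, expKernel a s) + ENNReal.ofReal M with hC
  have hCtop : C ≠ ∞ := ENNReal.add_ne_top.2
    ⟨ENNReal.mul_ne_top (by simp) (lintegral_expKernel_ne_top ha), by simp⟩
  refine ⟨C, hCtop, fun δ hδ hδh u hu hum => ?_⟩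
  have hm1 : Measurable fun s => ENNReal.ofReal δ * (ENNReal.ofReal M' * expKernel a s) :=
    ((measurable_expKernel a).const_mul _).const_mul _
  have hm2 : Measurable ((Set.Icc 0 δ).indicator fun _ : ℝ => ENNReal.ofReal M) :=
    measurable_const.indicator measurableSet_Icc
  refine normL2_le_of_conv_bound (k := fun s =>
    ENNReal.ofReal δ * (ENNReal.ofReal M' * expKernel a s) +
      (Set.Icc 0 δ).indicator (fun _ => ENNReal.ofReal M) s) (hm1.add hm2) ?_
    (ENNReal.mul_ne_top (by simp) hCtop) hum fun t ht => ?_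
  · rw [lintegral_add_left hm1, lintegral_const_mul _ ((measurable_expKernel a).const_mul _),
      lintegral_const_mul _ (measurable_expKernel a), lintegral_indicator measurableSet_Icc,
      setLIntegral_const, Real.volume_Icc, sub_zero, hC, mul_add, mul_comm (ENNReal.ofReal M)]
  set s : ℝ := ⌊t / δ⌋₊ * δ with hs
  have hs0 : 0 ≤ s := by positivity
  have hst : s ≤ t := floor_mul_le hδ ht
  have hts : t < s + δ := lt_floor_mul_add hδ t
  -- For `τ ≤ s` the mean value inequality gives a factor `δ`; for `s < τ ≤ t` the kernel is merely
  -- bounded, but on a window of length at most `δ`. Both parts have `L¹` norm `O(δ)`.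
  refine ⟨fun τ => G.kernel (t - τ) - if τ ≤ s then G.kernel (s - τ) else 0, fun τ h0 h1 => ?_, ?_⟩
  · have htτ : 0 ≤ t - τ := by linarith
    beta_reduce
    by_cases hτs : τ ≤ s
    · refine le_trans ?_ le_self_add
      have hsτ : 0 ≤ s - τ := by linarith
      rw [if_pos hτs, expKernel, Set.indicator_of_mem (Set.mem_Ici.2 htτ),
        ← ENNReal.ofReal_mul hM'0, ← ENNReal.ofReal_mul hδ.le, Real.enorm_eq_ofReal_abs]
      refine ENNReal.ofReal_le_ofReal ?_
      have hmv := norm_image_sub_le_of_norm_deriv_le_segment' (f := G.kernel) (f' := G.kernel')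
        (a := s - τ) (b := t - τ) (C := M * Real.exp (-a * (s - τ)))
        (fun x _ => (G.hasDerivAt_kernel x).hasDerivWithinAt)
        (fun x hx => by
          refine (hb x (hsτ.trans hx.1)).2.trans ?_
          refine mul_le_mul_of_nonneg_left (Real.exp_le_exp.2 ?_) hM
          have := mul_le_mul_of_nonneg_left hx.1 ha.le
          linarith)
        (t - τ) ⟨by linarith, le_rfl⟩
      rw [Real.norm_eq_abs] at hmv
      refine hmv.trans ?_
      have e1 : M * Real.exp (-a * (s - τ)) ≤ M' * Real.exp (-a * (t - τ)) := by
        rw [hM', mul_assoc, ← Real.exp_add]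
        refine mul_le_mul_of_nonneg_left (Real.exp_le_exp.2 ?_) hM
        have : a * t ≤ a * (s + h) := mul_le_mul_of_nonneg_left (by linarith) ha.le
        linarith
      calc M * Real.exp (-a * (s - τ)) * (t - τ - (s - τ))
          ≤ M' * Real.exp (-a * (t - τ)) * δ := by
            refine mul_le_mul e1 (by linarith) (by linarith) (by positivity)
        _ = _ := by ring
    · refine le_trans ?_ le_add_self
      rw [if_neg hτs, sub_zero, Set.indicator_of_mem (Set.mem_Icc.2 ⟨htτ, by linarith⟩),
        Real.enorm_eq_ofReal_abs]
      refine ENNReal.ofReal_le_ofReal ((hb _ htτ).1.trans ?_)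
      refine mul_le_of_le_one_right hM (Real.exp_le_one_iff.2 ?_)
      have := mul_nonneg ha.le htτ
      linarith
  · have hint : ∀ r b c : ℝ, IntervalIntegrable (fun τ => G.kernel (r - τ) * u τ) volume b c :=
      fun r b c => (hu b c).continuousOn_mul
        (G.continuous_kernel.comp (continuous_const.sub continuous_id)).continuousOn
    have e1 : ∫ τ in (0 : ℝ)..t, (if τ ≤ s then G.kernel (s - τ) else 0) * u τ =
        ∫ τ in (0 : ℝ)..s, G.kernel (s - τ) * u τ := by
      rw [intervalIntegral.integral_of_le ht, intervalIntegral.integral_of_le hs0,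
        ← integral_indicator measurableSet_Ioc, ← integral_indicator measurableSet_Ioc]
      congr 1
      ext τ
      by_cases h1 : τ ≤ s
      · have : τ ≤ t := h1.trans hst
        simp [Set.indicator, h1, this]
      · simp [Set.indicator, h1]
    have hint2 : IntervalIntegrable
        (fun τ => (if τ ≤ s then G.kernel (s - τ) else 0) * u τ) volume 0 t := by
      have := (intervalIntegrable_iff.1 (hint s 0 t)).indicator (measurableSet_Iic (a := s))
      refine (intervalIntegrable_iff.2 this).congr (fun τ _ => ?_)
      by_cases h1 : τ ≤ s <;> simp [Set.indicator, h1]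
    rw [Pi.sub_apply, sampleHold_apply _ ht, response_eq_kernel hD, response_eq_kernel hD, ← hs,
      ← e1, ← intervalIntegral.integral_sub (hint t 0 t) hint2]
    simp only [sub_mul]

end CTSystem

/-! ### Sample-and-hold error of a system driven by a zero-order hold -/

/-- Equivalence of norms in finite dimension, when `φ` may fail to be injective (unobservable
states). A linear right inverse on the range of `z ↦ φ z` in `L²` is continuous and selects `z'`;
continuity upgrades almost everywhere equality to equality on the interval. -/
theorem exists_rep_enorm_le {V : Type} [NormedAddCommGroup V] [NormedSpace ℝ V]
    [FiniteDimensional ℝ V] {d : ℝ} (hd : 0 < d) (φ : V →ₗ[ℝ] (ℝ → ℝ))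
    (hφ : ∀ z, ContinuousOn (φ z) (Set.Icc 0 d)) :
    ∃ M : ℝ≥0∞, M ≠ ∞ ∧ ∀ z, ∃ z', (∀ θ ∈ Set.Icc 0 d, φ z θ = φ z' θ) ∧
      ‖z'‖ₑ ≤ M * eLpNorm (φ z) 2 (volume.restrict (Set.Icc 0 d)) := by
  have hmem : ∀ z, MemLp (φ z) 2 (volume.restrict (Set.Icc 0 d)) := by
    intro z
    obtain ⟨C, hC⟩ := isCompact_Icc.exists_bound_of_continuousOn (hφ z)
    have : IsFiniteMeasure (volume.restrict (Set.Icc 0 d)) := ⟨by simp⟩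
    exact MemLp.of_bound ((hφ z).aestronglyMeasurable measurableSet_Icc) C
      ((ae_restrict_iff' measurableSet_Icc).2 (ae_of_all _ hC))
  let Φ : V →ₗ[ℝ] Lp ℝ 2 (volume.restrict (Set.Icc 0 d)) :=
    { toFun := fun z => (hmem z).toLp
      map_add' := fun z w => by
        rw [← MemLp.toLp_add]
        exact MemLp.toLp_congr _ _ (ae_of_all _ fun θ => by simp)
      map_smul' := fun a z => by
        rw [RingHom.id_apply, ← MemLp.toLp_const_smul]
        exact MemLp.toLp_congr _ _ (ae_of_all _ fun θ => by simp) }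
  obtain ⟨s, hs⟩ := Φ.rangeRestrict.exists_rightInverse_of_surjective Φ.range_rangeRestrict
  let s' := LinearMap.toContinuousLinearMap s
  refine ⟨‖s'‖ₑ, enorm_ne_top, fun z => ⟨s' (Φ.rangeRestrict z), ?_, ?_⟩⟩
  · have h1 : Φ z = Φ (s' (Φ.rangeRestrict z)) := by
      have := congrArg Subtype.val (LinearMap.congr_fun hs (Φ.rangeRestrict z))
      exact this.symm
    have h2 : φ z =ᵐ[volume.restrict (Set.Icc 0 d)] φ (s' (Φ.rangeRestrict z)) :=
      (MemLp.toLp_eq_toLp_iff (hmem _) (hmem _)).1 h1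
    exact Measure.eqOn_Icc_of_ae_eq volume hd.ne h2 (hφ _) (hφ _)
  · refine (s'.le_opENorm _).trans ?_
    gcongr
    exact (Lp.enorm_toLp (hmem z)).le

namespace CTSystem

variable {n : ℕ} (G : CTSystem n)

/-- The output on a time interval with constant input `c` and initial state `x`. -/
def slotOutput : ((Fin n → ℝ) × ℝ) →ₗ[ℝ] (ℝ → ℝ) where
  toFun z θ := G.C ⬝ᵥ (NormedSpace.exp (θ • G.A) *ᵥ z.1 + z.2 • G.stepState θ) + G.D * z.2
  map_add' z w := by
    ext θ
    simp only [Prod.fst_add, Prod.snd_add, Matrix.mulVec_add, add_smul, dotProduct_add,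
      Pi.add_apply]
    ring
  map_smul' a z := by
    ext θ
    simp only [Prod.smul_fst, Prod.smul_snd, Matrix.mulVec_smul, smul_eq_mul, mul_smul,
      dotProduct_add, dotProduct_smul, Pi.smul_apply, RingHom.id_apply]
    ring

theorem slotOutput_apply (z : (Fin n → ℝ) × ℝ) (θ : ℝ) : G.slotOutput z θ =
    G.C ⬝ᵥ (NormedSpace.exp (θ • G.A) *ᵥ z.1 + z.2 • G.stepState θ) + G.D * z.2 := rfl

theorem hasDerivAt_slotOutput (z : (Fin n → ℝ) × ℝ) (θ : ℝ) :
    HasDerivAt (G.slotOutput z)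
      (G.C ⬝ᵥ (NormedSpace.exp (θ • G.A) *ᵥ (G.A *ᵥ z.1 + z.2 • G.B))) θ := by
  have h1 := hasDerivAt_dotProduct_exp G.A G.C z.1 θ
  have h2 : HasDerivAt (fun θ => ∫ s in (0 : ℝ)..θ, G.kernel s) (G.kernel θ) θ :=
    (G.continuous_kernel.integral_hasStrictDerivAt 0 θ).hasDerivAt
  have h3 := (h1.add (h2.const_mul z.2)).add_const (G.D * z.2)
  have e : G.slotOutput z = fun θ => G.C ⬝ᵥ (NormedSpace.exp (θ • G.A) *ᵥ z.1) +
      z.2 * (∫ s in (0 : ℝ)..θ, G.kernel s) + G.D * z.2 := by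
    ext θ
    rw [slotOutput_apply, dotProduct_add, dotProduct_smul, stepState,
      dotProduct_intervalIntegral _ ((continuous_exp_mulVec G.A G.B).intervalIntegrable _ _)]
    rfl
  rw [e]
  refine HasDerivAt.congr_deriv h3 ?_
  rw [Matrix.mulVec_add, dotProduct_add, Matrix.mulVec_smul, dotProduct_smul]
  rfl

theorem exists_slotOutput_lipschitz (d : ℝ) : ∃ K : ℝ, 0 ≤ K ∧ ∀ z, ∀ θ ∈ Set.Icc 0 d,
    ∀ θ' ∈ Set.Icc 0 d, |G.slotOutput z θ - G.slotOutput z θ'| ≤ K * ‖z‖ * |θ - θ'| := by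
  have hcont : Continuous fun θ : ℝ =>
      ∑ i, |(G.C ᵥ* NormedSpace.exp (θ • G.A)) i| :=
    continuous_finsetSum _ fun i _ => continuous_abs.comp
      ((continuous_apply i).comp (continuous_const.matrix_vecMul (continuous_exp_smul G.A)))
  obtain ⟨K₁, hK₁⟩ := (isCompact_Icc (a := (0 : ℝ)) (b := d)).exists_bound_of_continuousOn
    hcont.continuousOn
  let ψ : ((Fin n → ℝ) × ℝ) →ₗ[ℝ] (Fin n → ℝ) :=
    LinearMap.coprod G.A.mulVecLin (LinearMap.toSpanSingleton ℝ _ G.B)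
  let ψ' := LinearMap.toContinuousLinearMap ψ
  refine ⟨|K₁| * ‖ψ'‖, by positivity, fun z θ hθ θ' hθ' => ?_⟩
  have key := (convex_Icc (0 : ℝ) d).norm_image_sub_le_of_norm_hasDerivWithin_le
    (f := G.slotOutput z) (C := |K₁| * ‖ψ'‖ * ‖z‖)
    (fun x _ => (G.hasDerivAt_slotOutput z x).hasDerivWithinAt) (fun x hx => ?_) hθ' hθ
  · exact key
  · have h1 : ‖G.A *ᵥ z.1 + z.2 • G.B‖ ≤ ‖ψ'‖ * ‖z‖ := ψ'.le_opNorm z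
    rw [Matrix.dotProduct_mulVec, mul_assoc]
    have h2 := hK₁ x hx
    rw [Real.norm_eq_abs, abs_of_nonneg (Finset.sum_nonneg fun _ _ => abs_nonneg _)] at h2
    calc ‖(G.C ᵥ* NormedSpace.exp (x • G.A)) ⬝ᵥ (G.A *ᵥ z.1 + z.2 • G.B)‖
        ≤ ∑ i, |(G.C ᵥ* NormedSpace.exp (x • G.A)) i| * ‖G.A *ᵥ z.1 + z.2 • G.B‖ := by
          refine (norm_sum_le _ _).trans (Finset.sum_le_sum fun i _ => ?_)
          rw [norm_mul, Real.norm_eq_abs]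
          gcongr
          exact norm_le_pi_norm _ i
      _ ≤ |K₁| * (‖ψ'‖ * ‖z‖) := by
          rw [← Finset.sum_mul]
          exact mul_le_mul (h2.trans (le_abs_self _)) h1 (norm_nonneg _) (abs_nonneg _)

/-- The Lipschitz constant is linear in the size of the initial data, and the data may be exchanged
for a representative controlled by the output itself. The oscillation on a slot is thus measured
against the output, not against the possibly large state. -/
theorem exists_slotOutput_sub_le {d : ℝ} (hd : 0 < d) : ∃ M : ℝ≥0∞, M ≠ ∞ ∧
    ∀ z, ∀ θ ∈ Set.Icc 0 d, ∀ θ' ∈ Set.Icc 0 d,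
      ‖G.slotOutput z θ - G.slotOutput z θ'‖ₑ ≤
        ENNReal.ofReal |θ - θ'| * M * eLpNorm (G.slotOutput z) 2 (volume.restrict (Set.Icc 0 d)) := by
  obtain ⟨K, hK, hlip⟩ := G.exists_slotOutput_lipschitz d
  obtain ⟨M, hM, hrep⟩ := exists_rep_enorm_le hd G.slotOutput
    (fun z θ _ => (G.hasDerivAt_slotOutput z θ).continuousAt.continuousWithinAt)
  refine ⟨ENNReal.ofReal K * M, ENNReal.mul_ne_top (by simp) hM, fun z θ hθ θ' hθ' => ?_⟩
  obtain ⟨z', hz', hnorm⟩ := hrep z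
  rw [hz' θ hθ, hz' θ' hθ', Real.enorm_eq_ofReal_abs]
  calc ENNReal.ofReal |G.slotOutput z' θ - G.slotOutput z' θ'|
      ≤ ENNReal.ofReal (K * ‖z'‖ * |θ - θ'|) :=
        ENNReal.ofReal_le_ofReal (hlip z' θ hθ θ' hθ')
    _ = ENNReal.ofReal |θ - θ'| * (ENNReal.ofReal K * ‖z'‖ₑ) := by
        rw [ENNReal.ofReal_mul (by positivity), ENNReal.ofReal_mul hK, ofReal_norm,
          mul_comm]
    _ ≤ _ := by
        rw [mul_assoc, mul_assoc]
        gcongr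

theorem response_zoh {d : ℝ} (hd : 0 < d) (v : ℕ → ℝ) (k : ℕ) {θ : ℝ} (h0 : 0 ≤ θ)
    (h1 : θ < d) : G.response (zoh d v) (k * d + θ) =
      G.slotOutput (G.state (zoh d v) (k * d), v k) θ := by
  rw [G.response_eq_state (intervalIntegrable_zoh hd v), G.state_zoh hd v k h0 h1.le,
    zoh_apply hd v k h0 h1, slotOutput_apply]

/-- The sample-and-hold error of a system driven by a zero-order hold of period `d` is `O(δ)`
relative to the output, when `δ` divides `d`. -/
theorem exists_normL2_response_zoh_sub_le {d : ℝ} (hd : 0 < d) : ∃ C : ℝ≥0∞, C ≠ ∞ ∧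
    ∀ δ : ℝ, 0 < δ → (∃ l : ℕ, d = l * δ) → ∀ v : ℕ → ℝ,
      normL2 (G.response (zoh d v) - sampleHold δ (G.response (zoh d v))) ≤
        ENNReal.ofReal δ * C * normL2 (G.response (zoh d v)) := by
  obtain ⟨M, hM, hslot⟩ := G.exists_slotOutput_sub_le hd
  refine ⟨M * ENNReal.ofReal d ^ (1 / 2 : ℝ), ENNReal.mul_ne_top hM (by simp), ?_⟩
  rintro δ hδ ⟨l, hl⟩ v
  set y := G.response (zoh d v) with hy
  have hsq : (ENNReal.ofReal d ^ (1 / 2 : ℝ)) ^ 2 = ENNReal.ofReal d := by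
    rw [← ENNReal.rpow_natCast, ← ENNReal.rpow_mul]; simp
  have : normL2 (y - sampleHold δ y) ^ 2 ≤
      (ENNReal.ofReal δ * (M * ENNReal.ofReal d ^ (1 / 2 : ℝ)) * normL2 y) ^ 2 := by
    rw [normL2_sq, mul_pow, normL2_sq, lintegral_Ici_eq_tsum hd, lintegral_Ici_eq_tsum hd,
      ← ENNReal.tsum_mul_left]
    refine ENNReal.tsum_le_tsum fun k => ?_
    set φ := G.slotOutput (G.state (zoh d v) (k * d), v k) with hφ
    have hyφ : ∀ θ, 0 ≤ θ → θ < d → y (k * d + θ) = φ θ := fun θ h0 h1 =>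
      G.response_zoh hd v k h0 h1
    have hI : ∫⁻ θ in Set.Ico 0 d, ‖y (k * d + θ)‖ₑ ^ 2 =
        eLpNorm φ 2 (volume.restrict (Set.Icc 0 d)) ^ 2 := by
      rw [eLpNorm_two_sq, setLIntegral_congr Ico_ae_eq_Icc.symm]
      exact setLIntegral_congr_fun measurableSet_Ico fun θ hθ => by
        simp only [hyφ θ hθ.1 hθ.2]
    calc ∫⁻ θ in Set.Ico 0 d, ‖(y - sampleHold δ y) (k * d + θ)‖ₑ ^ 2
        ≤ ∫⁻ θ in Set.Ico 0 d, (ENNReal.ofReal δ * M *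
            eLpNorm φ 2 (volume.restrict (Set.Icc 0 d))) ^ 2 := by
          refine setLIntegral_mono' measurableSet_Ico fun θ hθ => pow_le_pow_left' ?_ 2
          have hkd : (k : ℝ) * d = ((k * l : ℕ) : ℝ) * δ := by rw [hl]; push_cast; ring
          have hθ0 : 0 ≤ θ := hθ.1
          -- As `δ` divides `d`, the sampling grid restarts at every slot, so the sampling instant
          -- lies in the same slot as the point itself.
          have hfl : (⌊(k * d + θ) / δ⌋₊ : ℝ) * δ = k * d + ⌊θ / δ⌋₊ * δ := by
            have := floor_sub_natCast_mul hδ (k * l) (t := k * d + θ) (by rw [hkd]; linarith)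
            rw [← hkd, add_sub_cancel_left] at this
            linarith
          have h1 : (0 : ℝ) ≤ ⌊θ / δ⌋₊ * δ := by positivity
          have h2 := floor_mul_le hδ hθ0
          have h3 := lt_floor_mul_add hδ θ
          rw [Pi.sub_apply, sampleHold_apply _ (by positivity), hfl, hyφ θ hθ0 hθ.2,
            hyφ _ h1 (h2.trans_lt hθ.2)]
          refine (hslot _ θ ⟨hθ0, hθ.2.le⟩ _ ⟨h1, h2.trans hθ.2.le⟩).trans ?_
          gcongr
          rw [abs_of_nonneg (by linarith)]
          linarith
      _ = _ := by
          rw [setLIntegral_const, Real.volume_Ico, sub_zero, hI, mul_pow, mul_pow, mul_pow,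
            mul_pow, hsq]
          ring
  exact (ENNReal.pow_right_strictMono two_ne_zero).le_iff_le.1 this

end CTSystem

/-! ### Measurability -/

theorem CTSystem.aestronglyMeasurable_response {n : ℕ} (G : CTSystem n) {u : ℝ → ℝ}
    (hu : ∀ a b, IntervalIntegrable u volume a b) (hum : AEStronglyMeasurable u) :
    AEStronglyMeasurable (G.response u) := by
  rw [show G.response u = fun t => G.C ⬝ᵥ G.state u t + G.D * u t from
    funext (G.response_eq_state hu)]
  exact (continuous_const.dotProduct (G.continuous_state hu)).aestronglyMeasurable.add
    (hum.const_mul _)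

theorem CTSystem.continuous_response {n : ℕ} (G : CTSystem n) (hD : G.D = 0) {u : ℝ → ℝ}
    (hu : ∀ a b, IntervalIntegrable u volume a b) : Continuous (G.response u) := by
  rw [show G.response u = fun t => G.C ⬝ᵥ G.state u t by
    funext t; rw [G.response_eq_state hu, hD, zero_mul, add_zero]]
  exact continuous_const.dotProduct (G.continuous_state hu)

theorem measurable_delay (d : ℝ) {g : ℝ → ℝ} (hg : Measurable g) : Measurable (delay d g) := by
  unfold delay
  exact Measurable.ite measurableSet_Ici (hg.comp (measurable_id.sub_const d)) measurable_const

/-! ### Upper estimate for the approximations -/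

section Upper

variable {nF nP nK : ℕ} {F : CTSystem nF} (P : CTSystem nP) (K : DTSystem nK 1 1)

/-- The sampling error of the `F` branch is charged to `u` and that of the `P` branch to its own
output. The constant does not depend on `l` or `u`. -/
theorem exists_normL2_sampleHold_interpError_le (hF : F.IsStable) (hFD : F.D = 0) {L : ℕ}
    (hL : 0 < L) (m : ℕ) {h : ℝ} (hh : 0 < h) : ∃ C : ℝ≥0∞, C ≠ ∞ ∧ ∀ l : ℕ, 1 ≤ l →
      ∀ u : ℝ → ℝ, (∀ a b, IntervalIntegrable u volume a b) → AEStronglyMeasurable u →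
      normL2 (sampleHold (h / (L * l : ℕ)) (interpError F P K L m h u)) ≤
        normL2 (interpError F P K L m h u) + ENNReal.ofReal (h / (L * l : ℕ)) * C *
          (normL2 (interpError F P K L m h u) + normL2 u) := by
  have hL' : (0 : ℝ) < L := by exact_mod_cast hL
  obtain ⟨C₁, hC₁, hb₁⟩ := hF.exists_normL2_response_le hFD
  obtain ⟨C₂, hC₂, hb₂⟩ := hF.exists_normL2_sub_sampleHold_le hFD h
  obtain ⟨C₃, hC₃, hb₃⟩ := P.exists_normL2_response_zoh_sub_le (div_pos hh hL')
  refine ⟨C₂ + C₃ * (1 + C₁), ENNReal.add_ne_top.2 ⟨hC₂, ENNReal.mul_ne_top hC₃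
    (ENNReal.add_ne_top.2 ⟨ENNReal.one_ne_top, hC₁⟩)⟩, fun l hl u hu hum => ?_⟩
  have hl' : (1 : ℝ) ≤ l := by exact_mod_cast hl
  have hL1 : (1 : ℝ) ≤ L := by exact_mod_cast hL
  set δ : ℝ := h / (L * l : ℕ) with hδdef
  have hδ : 0 < δ := by rw [hδdef]; push_cast; positivity
  have hδh : δ ≤ h := by
    rw [hδdef]; push_cast
    exact div_le_self hh.le (by nlinarith)
  have hmδ : (m : ℝ) * h = ((m * (L * l) : ℕ) : ℝ) * δ := by
    rw [hδdef]; push_cast; field_simp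
  have hdδ : h / L = l * δ := by
    rw [hδdef]; push_cast; field_simp
  set v := K.scalarResponse (upsample L (sampler h (F.response u))) with hv
  set g := delay (m * h) (F.response u) with hg
  set y := P.response (zoh (h / L) v) with hy
  have hT : interpError F P K L m h u = g - y := rfl
  have hgm : AEStronglyMeasurable g (volume.restrict (Set.Ici 0)) :=
    (measurable_delay _ (F.continuous_response hFD hu).measurable).aestronglyMeasurable
  have hym : AEStronglyMeasurable y (volume.restrict (Set.Ici 0)) :=
    (P.aestronglyMeasurable_response (intervalIntegrable_zoh (div_pos hh hL') v)
      (measurable_zoh _ v).aestronglyMeasurable).restrict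
  have hsm : ∀ f : ℝ → ℝ, AEStronglyMeasurable (sampleHold δ f) (volume.restrict (Set.Ici 0)) :=
    fun f => (measurable_zoh _ _).aestronglyMeasurable
  have e1 : normL2 (sampleHold δ (g - y)) = normL2 ((g - y) + ((y - sampleHold δ y) -
      (g - sampleHold δ g))) := by
    refine normL2_congr fun t ht => ?_
    simp only [Pi.add_apply, Pi.sub_apply, sampleHold_apply _ ht]
    ring
  have e2 : normL2 (g - sampleHold δ g) ≤ ENNReal.ofReal δ * C₂ * normL2 u := by
    rw [hg, hmδ, normL2_sub_sampleHold_delay hδ]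
    exact hb₂ δ hδ hδh u hu hum
  have e3 := hb₃ δ hδ ⟨l, hdδ⟩ v
  -- The output of `P` is recovered from the error signal, which avoids any gain bound for `K`.
  have e4 : normL2 y ≤ C₁ * normL2 u + normL2 (g - y) := by
    have : y = g - (g - y) := by abel
    calc normL2 y = normL2 (g - (g - y)) := by rw [← this]
      _ ≤ normL2 g + normL2 (g - y) := eLpNorm_sub_le hgm (hgm.sub hym) (by norm_num)
      _ ≤ _ := by
        gcongr
        rw [hg, normL2_delay (by positivity)]
        exact hb₁ u hum
  rw [hT, e1]
  calc normL2 ((g - y) + ((y - sampleHold δ y) - (g - sampleHold δ g)))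
      ≤ normL2 (g - y) + (normL2 (y - sampleHold δ y) + normL2 (g - sampleHold δ g)) :=
        (eLpNorm_add_le (hgm.sub hym) ((hym.sub (hsm y)).sub (hgm.sub (hsm g)))
          (by norm_num)).trans (add_le_add le_rfl
            (eLpNorm_sub_le (hym.sub (hsm y)) (hgm.sub (hsm g)) (by norm_num)))
    _ ≤ normL2 (g - y) + (ENNReal.ofReal δ * C₃ * (C₁ * normL2 u + normL2 (g - y)) +
          ENNReal.ofReal δ * C₂ * normL2 u) := by
        gcongr
        exact e3.trans (by gcongr)
    _ ≤ _ := by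
        refine add_le_add le_rfl ?_
        set a := normL2 (g - y)
        set b := normL2 u
        have : ENNReal.ofReal δ * (C₂ + C₃ * (1 + C₁)) * (a + b) =
            (ENNReal.ofReal δ * C₃ * (C₁ * b + a) + ENNReal.ofReal δ * C₂ * b) +
            ENNReal.ofReal δ * (C₂ * a + C₃ * b + C₃ * C₁ * a) := by ring
        rw [this]
        exact le_self_add

end Upper

/-! ### Step approximation in `L²` -/

theorem exists_normL2_zoh_sub_le {w : ℝ → ℝ} (hw : MemLp w 2) {ε : ℝ≥0∞} (hε : ε ≠ 0) :
    ∃ δ₀ > 0, ∀ δ : ℝ, 0 < δ → δ < δ₀ → ∃ s : ℕ → ℝ, normL2 (zoh δ s - w) ≤ ε := by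
  obtain ⟨g, hgs, hgw, hgc, hgm⟩ := hw.exists_hasCompactSupport_eLpNorm_sub_le (by norm_num)
    (ENNReal.half_pos hε).ne'
  obtain ⟨R, hR⟩ := hgs.isCompact.isBounded.subset_closedBall 0
  have hg0 : ∀ t, |R| < t → g t = 0 := by
    intro t ht
    by_contra hne
    have := hR (subset_tsupport g hne)
    rw [mem_closedBall_zero_iff, Real.norm_eq_abs] at this
    linarith [le_abs_self t, le_abs_self R]
  obtain ⟨η, hη, hηε⟩ : ∃ η : ℝ, 0 < η ∧
      ENNReal.ofReal η * ENNReal.ofReal (|R| + 1) ^ (1 / 2 : ℝ) ≤ ε / 2 := by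
    have ht : Tendsto (fun η : ℝ => ENNReal.ofReal η * ENNReal.ofReal (|R| + 1) ^ (1 / 2 : ℝ))
        (𝓝[>] 0) (𝓝 0) := by
      have : Tendsto (fun η : ℝ => ENNReal.ofReal η) (𝓝[>] 0) (𝓝 0) := by
        have := (ENNReal.continuous_ofReal.tendsto 0).mono_left
          (nhdsWithin_le_nhds (s := Set.Ioi 0))
        simpa using this
      simpa using ENNReal.Tendsto.mul_const this
        (Or.inr (show ENNReal.ofReal (|R| + 1) ^ (1 / 2 : ℝ) ≠ ∞ by simp))
    obtain ⟨η, h1, h2⟩ := ((ht.eventually_le_const (ENNReal.half_pos hε)).and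
      self_mem_nhdsWithin).exists
    exact ⟨η, h2, h1⟩
  obtain ⟨δ₀, hδ₀, huc⟩ := Metric.uniformContinuous_iff.1
    (hgs.uniformContinuous_of_continuous hgc) η hη
  -- The cap `1` ensures that beyond `|R| + 1` the sampling instant is also outside the support of
  -- `g`.
  refine ⟨min δ₀ 1, by positivity, fun δ hδ hδlt => ⟨sampler δ g, ?_⟩⟩
  have h1 : normL2 (sampleHold δ g - g) ≤ ε / 2 := by
    refine le_trans ?_ hηε
    have : normL2 (sampleHold δ g - g) ^ 2 ≤
        (ENNReal.ofReal η * ENNReal.ofReal (|R| + 1) ^ (1 / 2 : ℝ)) ^ 2 := by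
      rw [normL2_sq]
      calc ∫⁻ t in Set.Ici 0, ‖(sampleHold δ g - g) t‖ₑ ^ 2
          ≤ ∫⁻ t in Set.Ici 0, (Set.Icc 0 (|R| + 1)).indicator
              (fun _ => ENNReal.ofReal η ^ 2) t := by
            refine setLIntegral_mono' measurableSet_Ici fun t ht => ?_
            rw [Pi.sub_apply, sampleHold_apply _ ht]
            have h2 := floor_mul_le hδ ht
            have h3 := lt_floor_mul_add hδ t
            by_cases htR : t ≤ |R| + 1
            · rw [Set.indicator_of_mem (Set.mem_Icc.2 ⟨ht, htR⟩), Real.enorm_eq_ofReal_abs]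
              refine pow_le_pow_left' (ENNReal.ofReal_le_ofReal ?_) 2
              rw [← Real.dist_eq]
              refine (huc ?_).le
              rw [Real.dist_eq, abs_sub_comm, abs_of_nonneg (by linarith)]
              linarith [min_le_left δ₀ 1]
            · have h4 := min_le_right δ₀ 1
              rw [hg0 t (by linarith), hg0 _ (by linarith)]
              simp
        _ ≤ ∫⁻ t, (Set.Icc 0 (|R| + 1)).indicator (fun _ => ENNReal.ofReal η ^ 2) t :=
            setLIntegral_le_lintegral _ _
        _ = _ := by
            rw [lintegral_indicator measurableSet_Icc, setLIntegral_const, Real.volume_Icc,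
              sub_zero, mul_pow]
            congr 1
            rw [← ENNReal.rpow_natCast, ← ENNReal.rpow_mul]
            simp
    exact (ENNReal.pow_right_strictMono two_ne_zero).le_iff_le.1 this
  have h2 : normL2 (g - w) ≤ ε / 2 := by
    refine le_trans ?_ hgw
    rw [eLpNorm_sub_comm]
    exact eLpNorm_mono_measure _ Measure.restrict_le_self
  have e : zoh δ (sampler δ g) - w = (sampleHold δ g - g) + (g - w) := by
    rw [sub_add_sub_cancel]; rfl
  rw [e]
  refine (eLpNorm_add_le ?_ ?_ (by norm_num)).trans
    ((add_le_add h1 h2).trans_eq (ENNReal.add_halves ε))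
  · exact (measurable_zoh _ _).aestronglyMeasurable.sub hgc.aestronglyMeasurable
  · exact hgc.aestronglyMeasurable.sub hw.1.restrict

/-- Near-minimizers with slack `1 / (l + 1)` give one sequence that serves every tolerance at once.
-/
theorem exists_tendsto_zoh {w : ℝ → ℝ} (hw : MemLp w 2) {δ : ℕ → ℝ}
    (hδ : ∀ᶠ l in atTop, 0 < δ l) (hδ0 : Tendsto δ atTop (𝓝 0)) :
    ∃ s : ℕ → ℕ → ℝ, Tendsto (fun l => normL2 (zoh (δ l) (s l) - w)) atTop (𝓝 0) := by
  have hex : ∀ l : ℕ, ∃ s : ℕ → ℝ, normL2 (zoh (δ l) s - w) ≤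
      (⨅ s : ℕ → ℝ, normL2 (zoh (δ l) s - w)) + ((l : ℝ≥0∞) + 1)⁻¹ := by
    intro l
    by_cases htop : (⨅ s : ℕ → ℝ, normL2 (zoh (δ l) s - w)) = ∞
    · exact ⟨0, by rw [htop]; simp⟩
    · have hpos : ((l : ℝ≥0∞) + 1)⁻¹ ≠ 0 := ENNReal.inv_ne_zero.2 (by simp)
      obtain ⟨s, hs⟩ := iInf_lt_iff.1 (ENNReal.lt_add_right htop hpos)
      exact ⟨s, hs.le⟩
  choose s hs using hex
  refine ⟨s, ENNReal.tendsto_nhds_zero.2 fun ε hε => ?_⟩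
  obtain ⟨δ₀, hδ₀, happ⟩ := exists_normL2_zoh_sub_le hw (ENNReal.half_pos hε.ne').ne'
  have hinv : Tendsto (fun l : ℕ => ((l : ℝ≥0∞) + 1)⁻¹) atTop (𝓝 0) := by
    have := (tendsto_add_atTop_iff_nat (f := fun l : ℕ => (l : ℝ≥0∞)⁻¹) 1).2
      ENNReal.tendsto_inv_nat_nhds_zero
    simpa using this
  filter_upwards [hδ, hδ0.eventually_lt_const hδ₀,
    hinv.eventually_le_const (ENNReal.half_pos hε.ne')] with l h1 h2 h3
  obtain ⟨s', hs'⟩ := happ _ h1 h2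
  calc normL2 (zoh (δ l) (s l) - w) ≤ ε / 2 + ε / 2 :=
        (hs l).trans (add_le_add ((iInf_le _ s').trans hs') h3)
    _ = ε := ENNReal.add_halves ε

/-! ### Pointwise convergence of responses -/

section Pointwise

/-- The kernel is bounded on `[0, S]`, so `L¹` convergence of the inputs there controls the
difference uniformly in time; the moving instant is handled by continuity of the limit trajectory.
-/
theorem CTSystem.tendsto_dotProduct_state {n : ℕ} (G : CTSystem n) {u : ℕ → ℝ → ℝ} {u₀ : ℝ → ℝ}
    (hu : ∀ l a b, IntervalIntegrable (u l) volume a b)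
    (hu₀ : ∀ a b, IntervalIntegrable u₀ volume a b) {S : ℝ}
    (hlim : Tendsto (fun l => ∫⁻ τ in Set.Icc 0 S, ‖u l τ - u₀ τ‖ₑ) atTop (𝓝 0))
    {s : ℕ → ℝ} {s₀ : ℝ} (hs : ∀ᶠ l in atTop, s l ∈ Set.Icc 0 S) (hs₀ : Tendsto s atTop (𝓝 s₀)) :
    Tendsto (fun l => G.C ⬝ᵥ G.state (u l) (s l)) atTop (𝓝 (G.C ⬝ᵥ G.state u₀ s₀)) := by
  obtain ⟨K, hK⟩ := (isCompact_Icc (a := (0 : ℝ)) (b := S)).exists_bound_of_continuousOn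
    G.continuous_kernel.continuousOn
  have hc : Continuous fun t => G.C ⬝ᵥ G.state u₀ t :=
    continuous_const.dotProduct (G.continuous_state hu₀)
  have h1 : Tendsto (fun l => G.C ⬝ᵥ G.state u₀ (s l)) atTop (𝓝 (G.C ⬝ᵥ G.state u₀ s₀)) :=
    (hc.tendsto s₀).comp hs₀
  have hker : ∀ {f : ℝ → ℝ} (_ : ∀ a b, IntervalIntegrable f volume a b) (t : ℝ),
      G.C ⬝ᵥ G.state f t = ∫ τ in (0 : ℝ)..t, G.kernel (t - τ) * f τ := fun hf t => by
    have h := G.response_eq_state hf t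
    rw [response] at h
    exact (add_right_cancel h).symm
  have hint : ∀ {f : ℝ → ℝ} (_ : ∀ a b, IntervalIntegrable f volume a b) (t : ℝ),
      IntervalIntegrable (fun τ => G.kernel (t - τ) * f τ) volume 0 t := fun hf t =>
    (hf 0 t).continuousOn_mul
      (G.continuous_kernel.comp (continuous_const.sub continuous_id)).continuousOn
  have h2 : Tendsto (fun l => G.C ⬝ᵥ G.state (u l) (s l) - G.C ⬝ᵥ G.state u₀ (s l)) atTop
      (𝓝 0) := by
    rw [tendsto_iff_edist_tendsto_0]
    have hb : Tendsto (fun l => ENNReal.ofReal K * ∫⁻ τ in Set.Icc 0 S, ‖u l τ - u₀ τ‖ₑ) atTop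
        (𝓝 0) := by
      simpa using ENNReal.Tendsto.const_mul hlim (Or.inr (ENNReal.ofReal_ne_top (r := K)))
    refine tendsto_of_tendsto_of_tendsto_of_le_of_le' tendsto_const_nhds hb
      (Eventually.of_forall fun _ => zero_le) ?_
    filter_upwards [hs] with l hl
    rw [edist_zero_right, hker (hu l), hker hu₀,
      ← intervalIntegral.integral_sub (hint (hu l) _) (hint hu₀ _),
      intervalIntegral.integral_of_le hl.1]
    refine (enorm_integral_le_lintegral_enorm _).trans ?_
    rw [← lintegral_const_mul' _ _ ENNReal.ofReal_ne_top]
    refine (setLIntegral_mono' measurableSet_Ioc fun τ hτ => ?_).trans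
      (lintegral_mono_set fun τ hτ => ⟨hτ.1.le, hτ.2.trans hl.2⟩)
    rw [← mul_sub, enorm_mul]
    gcongr
    rw [Real.enorm_eq_ofReal_abs]
    exact ENNReal.ofReal_le_ofReal (hK _ ⟨by linarith [hτ.2], by linarith [hτ.1, hl.2]⟩)
  simpa using h2.add h1

/-- Each output sample depends continuously on finitely many inputs, so stability of `K` is
irrelevant. -/
theorem DTSystem.tendsto_scalarResponse {n : ℕ} (K : DTSystem n 1 1) {u : ℕ → ℕ → ℝ}
    {u₀ : ℕ → ℝ} (hu : ∀ k, Tendsto (fun l => u l k) atTop (𝓝 (u₀ k))) (k : ℕ) :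
    Tendsto (fun l => K.scalarResponse (u l) k) atTop (𝓝 (K.scalarResponse u₀ k)) := by
  have hmul : ∀ {p q : ℕ} (M : Matrix (Fin p) (Fin q) ℝ) {f : ℕ → Fin q → ℝ} {f₀ : Fin q → ℝ},
      Tendsto f atTop (𝓝 f₀) → Tendsto (fun l => M *ᵥ f l) atTop (𝓝 (M *ᵥ f₀)) := fun M _ f₀ hf =>
    (((continuous_const (y := M)).matrix_mulVec continuous_id).tendsto f₀).comp hf
  have hu' : ∀ k, Tendsto (fun l => (fun _ : Fin 1 => u l k)) atTop (𝓝 fun _ => u₀ k) :=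
    fun k => tendsto_pi_nhds.2 fun _ => hu k
  have hx : ∀ k, Tendsto (fun l => K.state (fun j _ => u l j) k) atTop
      (𝓝 (K.state (fun j _ => u₀ j) k)) := by
    intro k
    induction k with
    | zero => exact tendsto_const_nhds
    | succ k ih => exact (hmul K.A ih).add (hmul K.B (hu' k))
  exact tendsto_pi_nhds.1 ((hmul K.C (hx k)).add (hmul K.D (hu' k))) 0

theorem tendsto_lintegral_zoh_sub {d : ℝ} (hd : 0 < d) {v : ℕ → ℕ → ℝ} {v₀ : ℕ → ℝ}
    (hv : ∀ k, Tendsto (fun l => v l k) atTop (𝓝 (v₀ k))) (S : ℝ) :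
    Tendsto (fun l => ∫⁻ τ in Set.Icc 0 S, ‖zoh d (v l) τ - zoh d v₀ τ‖ₑ) atTop (𝓝 0) := by
  have h1 : Tendsto (fun l => ∑ k ∈ Finset.range (⌊S / d⌋₊ + 1), |v l k - v₀ k|) atTop
      (𝓝 0) := by
    have := tendsto_finsetSum (Finset.range (⌊S / d⌋₊ + 1)) fun k _ =>
      (((hv k).sub_const (v₀ k)).abs)
    simpa using this
  have h2 : Tendsto (fun l => ENNReal.ofReal
      (∑ k ∈ Finset.range (⌊S / d⌋₊ + 1), |v l k - v₀ k|) * volume (Set.Icc 0 S)) atTop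
      (𝓝 0) := by
    have := (ENNReal.continuous_ofReal.tendsto 0).comp h1
    rw [ENNReal.ofReal_zero] at this
    simpa using ENNReal.Tendsto.mul_const this
      (Or.inr (show volume (Set.Icc (0 : ℝ) S) ≠ ∞ by simp))
  refine tendsto_of_tendsto_of_tendsto_of_le_of_le tendsto_const_nhds h2
    (fun _ => zero_le) fun l => ?_
  refine (setLIntegral_mono' measurableSet_Icc fun τ hτ => ?_).trans_eq (setLIntegral_const _ _)
  have e : zoh d (v l) τ - zoh d v₀ τ = zoh d (fun k => v l k - v₀ k) τ := by
    simp [zoh, hτ.1]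
  rw [e, Real.enorm_eq_ofReal_abs]
  exact ENNReal.ofReal_le_ofReal (abs_zoh_le hd _ hτ.2)

theorem tendsto_lintegral_of_normL2 {u : ℕ → ℝ → ℝ} {u₀ : ℝ → ℝ}
    (hu : ∀ l, AEStronglyMeasurable (u l)) (hu₀ : AEStronglyMeasurable u₀)
    (h : Tendsto (fun l => normL2 (u l - u₀)) atTop (𝓝 0)) (S : ℝ) :
    Tendsto (fun l => ∫⁻ τ in Set.Icc 0 S, ‖u l τ - u₀ τ‖ₑ) atTop (𝓝 0) := by
  have hb : Tendsto (fun l => normL2 (u l - u₀) * volume (Set.Icc 0 S) ^ (1 / 2 : ℝ)) atTop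
      (𝓝 0) := by
    simpa using ENNReal.Tendsto.mul_const h
      (Or.inr (show volume (Set.Icc (0 : ℝ) S) ^ (1 / 2 : ℝ) ≠ ∞ by simp))
  refine tendsto_of_tendsto_of_tendsto_of_le_of_le tendsto_const_nhds hb
    (fun _ => zero_le) fun l => ?_
  have h1 := eLpNorm_le_eLpNorm_mul_rpow_measure_univ (p := 1) (q := 2)
    (μ := volume.restrict (Set.Icc (0 : ℝ) S)) (by norm_num) ((hu l).sub hu₀).restrict
  rw [eLpNorm_one_eq_lintegral_enorm, Measure.restrict_apply_univ] at h1
  refine h1.trans ?_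
  have e : 1 / (1 : ℝ≥0∞).toReal - 1 / (2 : ℝ≥0∞).toReal = (1 / 2 : ℝ) := by norm_num
  rw [e]
  gcongr
  exact eLpNorm_mono_measure _ (Measure.restrict_mono Set.Icc_subset_Ici_self le_rfl)

end Pointwise

/-! ### Lower estimate by Fatou's lemma, and the limit of the norms -/

section Lower

variable {nF nP nK : ℕ} (F : CTSystem nF) (P : CTSystem nP) (K : DTSystem nK 1 1)

/-- The sampling instants `s l ≤ t` tend to `t`. The possible jumps, at `m * h` and at the switching
times of the hold, lie on every sampling grid, so rounding down never crosses one. -/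
theorem tendsto_sampleHold_interpError (hFD : F.D = 0) {L : ℕ} (hL : 0 < L) (m : ℕ) {h : ℝ}
    (hh : 0 < h) {u : ℕ → ℝ → ℝ} {u₀ : ℝ → ℝ}
    (hu : ∀ l a b, IntervalIntegrable (u l) volume a b)
    (hu₀ : ∀ a b, IntervalIntegrable u₀ volume a b)
    (hlim : ∀ S, Tendsto (fun l => ∫⁻ τ in Set.Icc 0 S, ‖u l τ - u₀ τ‖ₑ) atTop (𝓝 0))
    {t : ℝ} (ht : 0 ≤ t) :
    Tendsto (fun l : ℕ => sampleHold (h / (L * l : ℕ)) (interpError F P K L m h (u l)) t) atTop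
      (𝓝 (interpError F P K L m h u₀ t)) := by
  have hL' : (0 : ℝ) < L := by exact_mod_cast hL
  have hd : 0 < h / L := div_pos hh hL'
  have hFr : ∀ {f : ℝ → ℝ} (_ : ∀ a b, IntervalIntegrable f volume a b) (s : ℝ),
      F.response f s = F.C ⬝ᵥ F.state f s := fun hf s => by
    rw [F.response_eq_state hf, hFD, zero_mul, add_zero]
  have hF : ∀ {s : ℕ → ℝ} {s₀ : ℝ}, (∀ᶠ l in atTop, s l ∈ Set.Icc 0 (s₀ + 1)) →
      Tendsto s atTop (𝓝 s₀) →
      Tendsto (fun l => F.response (u l) (s l)) atTop (𝓝 (F.response u₀ s₀)) := by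
    intro s s₀ h1 h2
    simp only [hFr hu₀, hFr (hu _)]
    exact F.tendsto_dotProduct_state hu hu₀ (hlim (s₀ + 1)) h1 h2
  set y : ℕ → ℕ → ℝ := fun l => upsample L (sampler h (F.response (u l))) with hy
  set y₀ : ℕ → ℝ := upsample L (sampler h (F.response u₀)) with hy₀
  have hyk : ∀ k, Tendsto (fun l => y l k) atTop (𝓝 (y₀ k)) := by
    intro k
    simp only [hy, hy₀, upsample]
    split_ifs
    · refine hF (Eventually.of_forall fun l => ⟨by positivity, by linarith⟩) tendsto_const_nhds
    · exact tendsto_const_nhds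
  have hv : ∀ k, Tendsto (fun l => K.scalarResponse (y l) k) atTop
      (𝓝 (K.scalarResponse y₀ k)) := K.tendsto_scalarResponse hyk
  set δ : ℕ → ℝ := fun l => h / (L * l : ℕ) with hδdef
  have hδ : ∀ l, 1 ≤ l → 0 < δ l := fun l hl => by
    have : (0 : ℝ) < l := by exact_mod_cast hl
    simp only [hδdef]; push_cast; positivity
  have hδ0 : Tendsto δ atTop (𝓝 0) := by
    refine Tendsto.const_div_atTop (tendsto_natCast_atTop_atTop.comp ?_) h
    exact tendsto_id.const_mul_atTop' hL
  set s : ℕ → ℝ := fun l => ⌊t / δ l⌋₊ * δ l with hs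
  have hsb : ∀ l, 1 ≤ l → t - δ l ≤ s l ∧ s l ≤ t ∧ 0 ≤ s l := fun l hl =>
    ⟨by have := lt_floor_mul_add (hδ l hl) t; simp only [hs]; linarith,
      floor_mul_le (hδ l hl) ht, mul_nonneg (Nat.cast_nonneg _) (hδ l hl).le⟩
  have hst : Tendsto s atTop (𝓝 t) := by
    refine tendsto_of_tendsto_of_tendsto_of_le_of_le' (g := fun l => t - δ l)
      (by simpa using hδ0.const_sub t) tendsto_const_nhds ?_ ?_
    · filter_upwards [eventually_ge_atTop 1] with l hl using (hsb l hl).1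
    · filter_upwards [eventually_ge_atTop 1] with l hl using (hsb l hl).2.1
  have e : ∀ l, sampleHold (h / (L * l : ℕ)) (interpError F P K L m h (u l)) t =
      delay (m * h) (F.response (u l)) (s l) -
        P.response (zoh (h / L) (K.scalarResponse (y l))) (s l) :=
    fun l => sampleHold_apply _ ht
  simp only [e]
  refine Tendsto.sub ?_ ?_
  · by_cases hmt : m * h ≤ t
    · have hms : ∀ l, 1 ≤ l → m * h ≤ s l := by
        intro l hl
        have hl' : (0 : ℝ) < l := by exact_mod_cast hl
        have hmδ : (m : ℝ) * h = ((m * (L * l) : ℕ) : ℝ) * δ l := by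
          simp only [hδdef]; push_cast; field_simp
        simp only [hs]
        rw [hmδ]
        have := (hδ l hl).le
        gcongr
        refine Nat.le_floor ?_
        rw [le_div_iff₀ (hδ l hl), ← hmδ]
        exact hmt
      rw [delay, if_pos hmt]
      have h1 : Tendsto (fun l => F.response (u l) (s l - m * h)) atTop
          (𝓝 (F.response u₀ (t - m * h))) := by
        refine hF ?_ (hst.sub_const _)
        filter_upwards [eventually_ge_atTop 1] with l hl
        exact ⟨by linarith [hms l hl], by linarith [(hsb l hl).2.1]⟩
      refine h1.congr' ?_
      filter_upwards [eventually_ge_atTop 1] with l hl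
      rw [delay, if_pos (hms l hl)]
    · rw [delay, if_neg hmt]
      refine tendsto_const_nhds.congr' ?_
      filter_upwards [eventually_ge_atTop 1] with l hl
      rw [delay, if_neg fun hc => hmt (hc.trans (hsb l hl).2.1)]
  · simp only [P.response_eq_state (intervalIntegrable_zoh hd _)]
    refine Tendsto.add ?_ (Tendsto.const_mul _ ?_)
    · refine P.tendsto_dotProduct_state (S := t) (fun l => intervalIntegrable_zoh hd _)
        (intervalIntegrable_zoh hd _) (tendsto_lintegral_zoh_sub hd hv t) ?_ hst
      filter_upwards [eventually_ge_atTop 1] with l hl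
      exact ⟨(hsb l hl).2.2, (hsb l hl).2.1⟩
    · rw [zoh, if_pos ht]
      refine (hv ⌊t / (h / L)⌋₊).congr' ?_
      filter_upwards [eventually_ge_atTop 1] with l hl
      have hl' : (0 : ℝ) < l := by exact_mod_cast hl
      have h1 : h / L = δ l * l := by
        simp only [hδdef]; push_cast; field_simp
      have hδl := hδ l hl
      rw [zoh, if_pos (hsb l hl).2.2]
      congr 1
      simp only [hs]
      -- Rounding `t` down to the fine grid leaves its slot of length `h / L` unchanged.
      rw [h1, ← div_div, ← div_div, mul_div_assoc, div_self hδl.ne', mul_one,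
        Nat.floor_div_natCast, Nat.floor_div_natCast, Nat.floor_natCast]

theorem normL2_interpError_div_le_liminf (hFD : F.D = 0) {L : ℕ} (hL : 0 < L) (m : ℕ) {h : ℝ}
    (hh : 0 < h) {w : ℝ → ℝ} (hw : MemLp w 2) (hwi : ∀ a b, IntervalIntegrable w volume a b)
    (hw0 : normL2 w ≠ 0) :
    normL2 (interpError F P K L m h w) / normL2 w ≤
      liminf (fun l : ℕ => inducedNorml2 (fastLift h (L * l) (interpError F P K L m h))) atTop := by
  have hL' : (0 : ℝ) < L := by exact_mod_cast hL
  set T := interpError F P K L m h with hT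
  set δ : ℕ → ℝ := fun l => h / (L * l : ℕ) with hδdef
  have hδ : ∀ l, 1 ≤ l → 0 < δ l := fun l hl => by
    have : (0 : ℝ) < l := by exact_mod_cast hl
    simp only [hδdef]; push_cast; positivity
  have hδ0 : Tendsto δ atTop (𝓝 0) := by
    refine Tendsto.const_div_atTop (tendsto_natCast_atTop_atTop.comp ?_) h
    exact tendsto_id.const_mul_atTop' hL
  have hwtop : normL2 w ≠ ∞ := (hw.restrict _).2.ne
  obtain ⟨s, hs⟩ := exists_tendsto_zoh hw ((eventually_ge_atTop 1).mono hδ) hδ0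
  -- At `l = 0` the period is `h / 0 = 0`, so a harmless integrable signal is substituted.
  set u : ℕ → ℝ → ℝ := fun l => if 1 ≤ l then zoh (δ l) (s l) else 0 with hu
  have hul : ∀ l, 1 ≤ l → u l = zoh (δ l) (s l) := fun l hl => if_pos hl
  have hum : ∀ l, AEStronglyMeasurable (u l) := fun l => by
    simp only [hu]; split_ifs
    · exact (measurable_zoh _ _).aestronglyMeasurable
    · exact aestronglyMeasurable_zero
  have hui : ∀ l a b, IntervalIntegrable (u l) volume a b := fun l a b => by
    simp only [hu]; split_ifs with hl
    · exact intervalIntegrable_zoh (hδ l hl) _ a b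
    · exact intervalIntegrable_const (c := (0 : ℝ))
  have hlim : Tendsto (fun l => normL2 (u l - w)) atTop (𝓝 0) := by
    refine hs.congr' ?_
    filter_upwards [eventually_ge_atTop 1] with l hl
    rw [hul l hl]
  have hnorm : Tendsto (fun l => normL2 (u l)) atTop (𝓝 (normL2 w)) := by
    have hup : Tendsto (fun l => normL2 w + normL2 (u l - w)) atTop (𝓝 (normL2 w)) := by
      simpa using hlim.const_add (normL2 w)
    have hlo : Tendsto (fun l => normL2 w - normL2 (u l - w)) atTop (𝓝 (normL2 w)) := by
      simpa using ENNReal.Tendsto.sub (tendsto_const_nhds (x := normL2 w)) hlim (Or.inl hwtop)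
    refine tendsto_of_tendsto_of_tendsto_of_le_of_le hlo hup (fun l => ?_) fun l => ?_
    · rw [tsub_le_iff_right]
      calc normL2 w = normL2 (u l - (u l - w)) := by rw [sub_sub_cancel]
        _ ≤ _ := eLpNorm_sub_le (hum l).restrict ((hum l).sub hw.1).restrict (by norm_num)
    · calc normL2 (u l) = normL2 (w + (u l - w)) := by rw [add_sub_cancel]
        _ ≤ _ := eLpNorm_add_le hw.1.restrict ((hum l).sub hw.1).restrict (by norm_num)
  have hfatou : normL2 (T w) ≤ liminf (fun l => normL2 (sampleHold (δ l) (T (u l)))) atTop :=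
    Lp.eLpNorm_lim_le_liminf_eLpNorm
      (fun l => (measurable_zoh _ _).aestronglyMeasurable) _
      ((ae_restrict_iff' measurableSet_Ici).2 (ae_of_all _ fun t ht =>
        tendsto_sampleHold_interpError F P K hFD hL m hh hui hwi
          (tendsto_lintegral_of_normL2 hum hw.1 hlim) ht))
  refine le_of_forall_lt fun c hc => ?_
  -- The gap between `c'` and `c''` absorbs the difference between `normL2 (u l)` and `normL2 w` for
  -- large `l`.
  obtain ⟨c', hcc', hc'⟩ := exists_between hc
  obtain ⟨c'', hcc'', hc''⟩ := exists_between hc'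
  refine hcc'.trans_le ?_
  have hx : c'' * normL2 w < normL2 (T w) :=
    (ENNReal.lt_div_iff_mul_lt (Or.inl hw0) (Or.inl hwtop)).1 hc''
  have hev1 := eventually_lt_of_lt_liminf (hx.trans_le hfatou)
  have hev2 : ∀ᶠ l in atTop, c' * normL2 (u l) < c'' * normL2 w := by
    have h1 : Tendsto (fun l => c' * normL2 (u l)) atTop (𝓝 (c' * normL2 w)) :=
      ENNReal.Tendsto.const_mul hnorm (Or.inr hcc''.ne_top)
    refine h1.eventually_lt_const ?_
    exact ENNReal.mul_lt_mul_left hw0 hwtop hcc''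
  refine le_liminf_of_le (by isBoundedDefault) ?_
  filter_upwards [hev1, hev2, eventually_ge_atTop 1, hnorm.eventually_ne hw0,
    hnorm.eventually_lt_const hwtop.lt_top] with l h1 h2 hl h3 h4
  have h5 := normL2_sampleHold_div_le hh (Nat.mul_pos hL hl) T (s l)
  rw [show h / ((L * l : ℕ) : ℝ) = δ l from rfl, ← hul l hl] at h5
  refine le_trans ?_ (h5 h3 h4.ne)
  rw [ENNReal.le_div_iff_mul_le (Or.inl h3) (Or.inl h4.ne)]
  exact (h2.trans h1).le

theorem interpError_congr (hFD : F.D = 0) (L m : ℕ) {h : ℝ} (hh : 0 < h) {w w' : ℝ → ℝ}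
    (hw : ∀ t, 0 ≤ t → w t = w' t) :
    interpError F P K L m h w = interpError F P K L m h w' := by
  have hF : ∀ t, 0 ≤ t → F.response w t = F.response w' t := by
    intro t ht
    rw [CTSystem.response_eq_kernel hFD, CTSystem.response_eq_kernel hFD]
    refine intervalIntegral.integral_congr fun τ hτ => ?_
    rw [Set.uIcc_of_le ht] at hτ
    simp only [hw τ hτ.1]
  have h1 : delay (m * h) (F.response w) = delay (m * h) (F.response w') := by
    funext t
    unfold delay
    split_ifs with ht
    · exact hF _ (by linarith)
    · rfl
  have h2 : sampler h (F.response w) = sampler h (F.response w') :=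
    funext fun k => hF _ (by positivity)
  funext t
  rw [interpError, interpError, h1, h2]

theorem tendsto_inducedNorml2_fastLift_interpError (hF : F.IsStable) (hFD : F.D = 0) {L : ℕ}
    (hL : 0 < L) (m : ℕ) {h : ℝ} (hh : 0 < h) :
    Tendsto (fun l : ℕ => inducedNorml2 (fastLift h (L * l) (interpError F P K L m h))) atTop
      (𝓝 (inducedNormL2 (interpError F P K L m h))) := by
  have hL' : (0 : ℝ) < L := by exact_mod_cast hL
  set T := interpError F P K L m h with hT
  refine tendsto_of_le_liminf_of_limsup_le ?_ ?_ (by isBoundedDefault) (by isBoundedDefault)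
  · refine iSup_le fun w => iSup_le fun hw => iSup_le fun hw0 => ?_
    -- Membership in `L²[0, ∞)` says nothing about negative times; cutting off there gives a signal
    -- in `L²(ℝ)` and changes neither the norm nor the output.
    set w' := (Set.Ici (0 : ℝ)).indicator w with hw'
    have heq : ∀ t, 0 ≤ t → w t = w' t := fun t ht => by
      rw [hw', Set.indicator_of_mem (Set.mem_Ici.2 ht)]
    have hmem : MemLp w' 2 := (memLp_indicator_iff_restrict measurableSet_Ici).2 hw
    have hint : ∀ a b, IntervalIntegrable w' volume a b := fun a b =>
      ((hmem.locallyIntegrable (by norm_num)).integrableOn_isCompact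
        isCompact_uIcc).intervalIntegrable
    rw [hT, interpError_congr F P K hFD L m hh heq, normL2_congr heq]
    exact normL2_interpError_div_le_liminf F P K hFD hL m hh hmem hint
      (by rwa [← normL2_congr heq])
  -- If the norm is infinite the upper estimate is empty; otherwise the correction `O(δ) (‖T‖ + 1)`
  -- is finite and tends to zero.
  · by_cases htop : inducedNormL2 T = ∞
    · rw [htop]; exact le_top
    obtain ⟨C, hC, hb⟩ := exists_normL2_sampleHold_interpError_le P K hF hFD hL m hh
    have hlim : Tendsto (fun l : ℕ => inducedNormL2 T +
        ENNReal.ofReal (h / (L * l : ℕ)) * C * (inducedNormL2 T + 1)) atTop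
        (𝓝 (inducedNormL2 T)) := by
      have hδ0 : Tendsto (fun l : ℕ => h / ((L * l : ℕ) : ℝ)) atTop (𝓝 0) := by
        refine Tendsto.const_div_atTop (tendsto_natCast_atTop_atTop.comp ?_) h
        exact tendsto_id.const_mul_atTop' hL
      have h1 := (ENNReal.continuous_ofReal.tendsto 0).comp hδ0
      rw [ENNReal.ofReal_zero] at h1
      have h2 := ENNReal.Tendsto.mul_const (ENNReal.Tendsto.mul_const h1 (Or.inr hC))
        (Or.inr (ENNReal.add_ne_top.2 ⟨htop, ENNReal.one_ne_top⟩))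
      simpa using h2.const_add (inducedNormL2 T)
    rw [← hlim.limsup_eq]
    refine limsup_le_limsup ?_ (by isBoundedDefault) (by isBoundedDefault)
    filter_upwards [eventually_ge_atTop 1] with l hl
    have hl' : (0 : ℝ) < l := by exact_mod_cast hl
    have hδ : 0 < h / ((L * l : ℕ) : ℝ) := by push_cast; positivity
    refine inducedNorml2_fastLift_le hh (Nat.mul_pos hL hl) T fun v h0 h1 => ?_
    set w := zoh (h / (L * l : ℕ)) v
    have hmem : MemL2 w := ⟨(measurable_zoh _ _).aestronglyMeasurable, h1.lt_top⟩
    have hTw : normL2 (T w) ≤ inducedNormL2 T * normL2 w := by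
      rw [← ENNReal.div_le_iff h0 h1]
      exact le_iSup_of_le w (le_iSup_of_le hmem (le_iSup_of_le h0 le_rfl))
    rw [ENNReal.div_le_iff h0 h1]
    refine (hb l hl w (intervalIntegrable_zoh hδ v)
      (measurable_zoh _ _).aestronglyMeasurable).trans ?_
    calc _ ≤ inducedNormL2 T * normL2 w + ENNReal.ofReal (h / (L * l : ℕ)) * C *
          (inducedNormL2 T * normL2 w + normL2 w) := by gcongr
      _ = _ := by ring

end Lower

end

end SampledData

/-! ### The main theorem -/

theorem mainTheorem5 {nF nP nK : ℕ}
    (F : SampledData.CTSystem nF) (hF : F.IsStable) (hFD : F.D = 0)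
    (P : SampledData.CTSystem nP) (hP : P.IsStable)
    (K : SampledData.DTSystem nK 1 1)
    (L : ℕ) (hL : 0 < L) (m : ℕ) (h : ℝ) (hh : 0 < h) :
    -- `K (↑L) = 𝐋_L⁻¹ K̃`
    (∀ v : ℕ → ℝ, K.scalarResponse (SampledData.upsample L v) =
      SampledData.unlift L (SampledData.liftedFilter K L v)) ∧
    -- `K̃` is a time-invariant finite-dimensional single-input `L`-output system
    (∃ (n : ℕ) (Kt : SampledData.DTSystem n 1 L), ∀ v : ℕ → ℝ,
      Kt.response (fun k _ => v k) = SampledData.liftedFilter K L v) ∧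
    -- `H_{h/L} 𝐋_L⁻¹` is the generalized hold
    (∀ v : ℕ → Fin L → ℝ, SampledData.zoh (h / L) (SampledData.unlift L v) =
      SampledData.genHold h v) ∧
    -- single-rate form of the error system
    (∀ (w : ℝ → ℝ) (t : ℝ), SampledData.interpError F P K L m h w t =
      SampledData.delay (m * h) (F.response w) t -
        P.response (SampledData.genHold h (SampledData.liftedFilter K L
          (SampledData.sampler h (F.response w)))) t) ∧
    -- the finite-dimensional approximations `T_{I,N}` with `N = L l`, `l ≥ 1`
    ∃ (n : ℕ → ℕ) (T : ∀ l : ℕ, SampledData.DTSystem (n l) (L * l) (L * l)),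
      (∀ l : ℕ, 1 ≤ l → ∀ w : ℕ → Fin (L * l) → ℝ,
        (T l).response w =
          SampledData.zDelay m (SampledData.G11 F h (L * l) w) +
            SampledData.G12 P h L l
              (SampledData.liftedFilter K L (SampledData.G21 F h (L * l) w))) ∧
      (∀ l : ℕ, 1 ≤ l → ∀ w : ℕ → Fin (L * l) → ℝ,
        (T l).response w =
          SampledData.fastLift h (L * l) (SampledData.interpError F P K L m h) w) ∧
      Tendsto (fun l : ℕ => SampledData.inducedNorml2 (T l).response) atTop
        (𝓝 (SampledData.inducedNormL2 (SampledData.interpError F P K L m h))) := by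
  refine ⟨SampledData.scalarResponse_upsample hL K, ?_,
    SampledData.zoh_unlift_eq_genHold hh hL, fun w t => ?_, ?_⟩
  · obtain ⟨n, G, hG⟩ := ((SampledData.realizable_liftedFilter hL K).comp
      (SampledData.Realizable.static
        (LinearMap.proj (R := ℝ) (φ := fun _ : Fin 1 => ℝ) 0))).exists_dtSystem
    exact ⟨n, G, fun v => hG _⟩
  · rw [← SampledData.zoh_unlift_eq_genHold hh hL, ← SampledData.scalarResponse_upsample hL]
    rfl
  · have hex : ∀ l : ℕ, ∃ (n : ℕ) (G : SampledData.DTSystem n (L * l) (L * l)), 1 ≤ l →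
        ∀ w, G.response w =
          SampledData.fastLift h (L * l) (SampledData.interpError F P K L m h) w := by
      intro l
      by_cases hl : 1 ≤ l
      · obtain ⟨n, G, hG⟩ :=
          (SampledData.realizable_fastLift_interpError F P K hL m hh hl).exists_dtSystem
        exact ⟨n, G, fun _ => hG⟩
      -- An arbitrary system at `l = 0`, invisible to the limit.
      · exact ⟨0, ⟨0, 0, 0, 0⟩, fun hc => absurd hc hl⟩
    choose n T hTl using hex
    refine ⟨n, T, fun l hl w => ?_, hTl, ?_⟩
    · rw [hTl l hl, SampledData.fastLift_interpError F P K hL m hh hl]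
    · refine (SampledData.tendsto_inducedNorml2_fastLift_interpError F P K hF hFD hL m
        hh).congr' ?_
      filter_upwards [eventually_ge_atTop 1] with l hl
      rw [← funext (hTl l hl)]
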